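/- Let $\mathbb K$ be $\mathbb R$ or $\mathbb C$, let $X$ be a smooth, finite dimensional, Hausdorff, second countable manifold and let $I=(0,1]$. Let $\mathcal E_M$ be the ring of all $r\in C^\infty(I,\mathbb K)$ such that $|r_\varepsilon|=O(\varepsilon^{-N})$ as $\varepsilon\to0$ for some $N\in\mathbb N$, let $\mathcal N$ be the ideal of those $r\in\mathcal E_M$ with $|r_\varepsilon|=O(\varepsilon^{m})$ for all $m\in\mathbb N$, and let $\widetilde{\mathbb K}=\mathcal E_M/\mathcal N$ be the ring of generalized numbers. Let $\mathcal E_M(X)$ be the ring of all $u\in C^\infty(I\times X,\mathbb K)$ such that for every compact $K\subseteq X$ and every linear differential operator $P$ on $X$ there is $N\in\mathbb N$ with $\sup_{x\in K}|Pu_\varepsilon(x)|=O(\varepsilon^{-N})$ as $\varepsilon\to0$, let $\mathcal N(X)$ be the ideal of those $u\in\mathcal E_M(X)$ such that $\sup_{x\in K}|u_\varepsilon(x)|=O(\varepsilon^m)$ for every compact $K\subseteq X$ and every $m\in\mathbb N$, and let $\mathcal G(X)=\mathcal E_M(X)/\mathcal N(X)$ be the special Colombeau algebra, a $\widetilde{\mathbb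 K}$-algebra. A compactly supported net is a smooth map $\varepsilon\mapsto x_\varepsilon$, $I\to X$, for which there is a compact $K\subseteq X$ with $x_\varepsilon\in K$ for all sufficiently small $\varepsilon$. Two such nets $(x_\varepsilon)_\varepsilon$, $(y_\varepsilon)_\varepsilon$ are equivalent if $d_g(x_\varepsilon,y_\varepsilon)=O(\varepsilon^m)$ as $\varepsilon\to0$ for every Riemannian metric $g$ on $X$ and every $m\in\mathbb N$; the set of equivalence classes is denoted by $\widetilde X_c$. For $u=[(u_\varepsilon)_\varepsilon]\in\mathcal G(X)$ and $x=[(x_\varepsilon)_\varepsilon]\in\widetilde X_c$ put $u(x)=[(u_\varepsilon(x_\varepsilon))_\varepsilon]\in\widetilde{\mathbb K}$. Let $\nu:\mathcal G(X)\to\widetilde{\mathbb K}$ be $\widetilde{\mathbb K}$-linear and multiplicative, $\nu(uv)=\nu(u)\nu(v)$ for all $u,v$, with $\nu\neq0$. Then there exists a unique $x\in\widetilde X_c$ such that $\nu(u)=u(x)$ for all $u\in\mathcal G(X)$. Here $u(x)$ does not depend on the representative: a compactly supported net $(x_\varepsilon)_\varepsilon$ represents $x$ if and only if $\nu(u)=[(u_\varepsilon(x_\varepsilon))_\varepsilon]$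 for all $u=[(u_\varepsilon)_\varepsilon]\in\mathcal G(X)$. -/

import Mathlib

open Set Filter Topology Asymptotics Manifold Bundle
open scoped ContDiff ENNReal

noncomputable section

namespace Colombeau

/-! The parameter interval is `I = (0, 1]`. A net indexed by `I` is written as a function on `ℝ`,
smooth on `Set.Ioc 0 1`; its values off `(0, 1]` are irrelevant, since nets that agree for small
`ε > 0` are identified in the quotients below. "As `ε → 0`" is the filter `𝓝[>] 0`. -/

instance contMDiffRing (𝕜 : Type*) [RCLike 𝕜] : ContMDiffRing 𝓘(ℝ, 𝕜) ∞ 𝕜 :=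
  { instNormedSpaceLieAddGroup with
    contMDiff_mul := by
      rw [← modelWithCornersSelf_prod, chartedSpaceSelf_prod, contMDiff_iff_contDiff]
      exact contDiff_mul }

/-- Near `0`, `ε⁻ᴺ` is dominated by `ε⁻ᴹ` for `N ≤ M`. -/
theorem isBigO_zpow_neg {N M : ℕ} (h : N ≤ M) :
    (fun ε : ℝ => ε ^ (-(N : ℤ))) =O[𝓝[>] 0] fun ε => ε ^ (-(M : ℤ)) := by
  refine IsBigO.of_bound 1 ?_
  filter_upwards [Ioc_mem_nhdsGT (zero_lt_one : (0 : ℝ) < 1)] with ε hε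
  rw [one_mul, Real.norm_of_nonneg (zpow_nonneg hε.1.le _),
    Real.norm_of_nonneg (zpow_nonneg hε.1.le _)]
  exact zpow_le_zpow_right_of_le_one₀ hε.1 hε.2 (by omega)

theorem zpow_neg_mul_zpow_neg (N M : ℕ) :
    (fun ε : ℝ => ε ^ (-(N : ℤ)) * ε ^ (-(M : ℤ)))
      =ᶠ[𝓝[>] 0] fun ε => ε ^ (-((N + M : ℕ) : ℤ)) := by
  filter_upwards [self_mem_nhdsWithin] with ε (hε : 0 < ε)
  rw [← zpow_add₀ hε.ne']
  congr 1
  push_cast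
  ring

theorem zpow_neg_mul_pow (N m : ℕ) :
    (fun ε : ℝ => ε ^ (-(N : ℤ)) * ε ^ (N + m)) =ᶠ[𝓝[>] 0] fun ε => ε ^ m := by
  filter_upwards [self_mem_nhdsWithin] with ε (hε : 0 < ε)
  rw [zpow_neg, zpow_natCast, pow_add, ← mul_assoc, inv_mul_cancel₀ (pow_ne_zero _ hε.ne'),
    one_mul]

/-! ### Generalized numbers -/

section Scalars

variable (𝕜 : Type*) [RCLike 𝕜]

/-- Moderate nets of scalars: smooth on `(0, 1]` and `O(ε⁻ᴺ)` for some `N`. -/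
def scalarModerate : Subring (ℝ → 𝕜) where
  carrier := {r | ContDiffOn ℝ ∞ r (Ioc 0 1) ∧
    ∃ N : ℕ, r =O[𝓝[>] 0] fun ε : ℝ => ε ^ (-(N : ℤ))}
  mul_mem' := by
    rintro r s ⟨hr, N, hN⟩ ⟨hs, M, hM⟩
    exact ⟨hr.mul hs, N + M, (hN.mul hM).trans_eventuallyEq (zpow_neg_mul_zpow_neg N M)⟩
  one_mem' := ⟨contDiffOn_const, 0, by simpa using isBigO_refl (fun _ : ℝ => (1 : ℝ)) _⟩
  add_mem' := by
    rintro r s ⟨hr, N, hN⟩ ⟨hs, M, hM⟩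
    exact ⟨hr.add hs, max N M, (hN.trans (isBigO_zpow_neg (le_max_left _ _))).add
      (hM.trans (isBigO_zpow_neg (le_max_right _ _)))⟩
  zero_mem' := ⟨contDiffOn_const, 0, isBigO_zero _ _⟩
  neg_mem' := by
    rintro r ⟨hr, N, hN⟩
    exact ⟨hr.neg, N, hN.neg_left⟩

/-- Negligible nets of scalars: `O(εᵐ)` for all `m`. -/
def scalarNegligible : Ideal (scalarModerate 𝕜) where
  carrier := {r | ∀ m : ℕ, (r : ℝ → 𝕜) =O[𝓝[>] 0] fun ε : ℝ => ε ^ m}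
  add_mem' := fun hr hs m => (hr m).add (hs m)
  zero_mem' := fun _ => isBigO_zero _ _
  smul_mem' := by
    rintro ⟨c, -, N, hN⟩ r hr m
    exact (hN.mul (hr (N + m))).trans_eventuallyEq (zpow_neg_mul_pow N m)

/-- The ring of generalized numbers. -/
def GenNumber : Type _ := scalarModerate 𝕜 ⧸ scalarNegligible 𝕜

instance : CommRing (GenNumber 𝕜) :=
  inferInstanceAs (CommRing (scalarModerate 𝕜 ⧸ scalarNegligible 𝕜))

end Scalars

section UniformBigO

variable (𝕜 : Type*) [RCLike 𝕜] (X : Type*)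

/-- `u = O(ε ↦ b ε)` as `ε → 0`, uniformly on `K`, that is `sup_{x ∈ K} |u_ε(x)| = O(b ε)`. -/
def UniformBigO (K : Set X) (u : ℝ → X → 𝕜) (b : ℝ → ℝ) : Prop :=
  (fun p : ℝ × X => u p.1 p.2) =O[𝓝[>] 0 ×ˢ 𝓟 K] fun p => b p.1

variable {𝕜 X}

theorem UniformBigO.trans {K : Set X} {u : ℝ → X → 𝕜} {b c : ℝ → ℝ} (h : UniformBigO 𝕜 X K u b)
    (h' : b =O[𝓝[>] 0] c) : UniformBigO 𝕜 X K u c :=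
  IsBigO.trans h (h'.comp_tendsto tendsto_fst)

theorem UniformBigO.mul {K : Set X} {u v : ℝ → X → 𝕜} {b c d : ℝ → ℝ} (h : UniformBigO 𝕜 X K u b)
    (h' : UniformBigO 𝕜 X K v c) (hd : (fun ε => b ε * c ε) =ᶠ[𝓝[>] 0] d) :
    UniformBigO 𝕜 X K (fun ε x => u ε x * v ε x) d :=
  (IsBigO.mul h h').trans_eventuallyEq (tendsto_fst.eventually hd)

theorem uniformBigO_iff {K : Set X} {u : ℝ → X → 𝕜} {b : ℝ → ℝ} :
    UniformBigO 𝕜 X K u b ↔ ∃ C : ℝ, ∀ᶠ ε in 𝓝[>] 0, ∀ x ∈ K, ‖u ε x‖ ≤ C * ‖b ε‖ := by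
  simp only [UniformBigO, isBigO_iff, eventually_prod_principal_iff]

theorem UniformBigO.comp {K : Set X} {u : ℝ → X → 𝕜} {b : ℝ → ℝ} (h : UniformBigO 𝕜 X K u b)
    {x : ℝ → X} (hx : ∀ᶠ ε in 𝓝[>] 0, x ε ∈ K) : (fun ε => u ε (x ε)) =O[𝓝[>] 0] b := by
  obtain ⟨C, hC⟩ := uniformBigO_iff.1 h
  refine IsBigO.of_bound C ?_
  filter_upwards [hC, hx] with ε h1 h2 using h1 _ h2

end UniformBigO

section Manifold

variable (𝕜 : Type*) [RCLike 𝕜] (E : Type*) [NormedAddCommGroup E] [NormedSpace ℝ E]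
  (X : Type*) [TopologicalSpace X] [ChartedSpace E X]

/-! ### The special Colombeau algebra -/

/-- The algebra of smooth `𝕜`-valued functions on `X`. -/
abbrev Smooth : Type _ := C^∞⟮𝓘(ℝ, E), X; 𝓘(ℝ, 𝕜), 𝕜⟯

/-- The linear differential operators on `X`: the algebra of operators on smooth functions
generated by the multiplications with smooth functions and the derivations (smooth vector fields).
For `𝕜 = ℂ` the `ℝ`-linear derivations are automatically `ℂ`-linear, because `0 = D(i²) = 2 i D(i)`,
so these are complex linear operators with complex coefficients. -/
def diffOps : Subalgebra ℝ (Module.End ℝ (Smooth 𝕜 E X)) :=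
  Algebra.adjoin ℝ
    ({P | ∃ f : Smooth 𝕜 E X, ∀ u, P u = f * u} ∪
     {P | ∃ D : Derivation ℝ (Smooth 𝕜 E X) (Smooth 𝕜 E X), ∀ u, P u = D u})

variable {𝕜 E X}

/-- Leibniz rule for linear differential operators. -/
theorem diffOps_leibniz {P : Module.End ℝ (Smooth 𝕜 E X)} (hP : P ∈ diffOps 𝕜 E X) :
    ∃ L : List (diffOps 𝕜 E X × diffOps 𝕜 E X), ∀ u v : Smooth 𝕜 E X,
      P (u * v) = (L.map fun Q => Q.1.1 u * Q.2.1 v).sum := by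
  induction hP using Algebra.adjoin_induction with
  | mem P h =>
    rcases h with ⟨f, hf⟩ | ⟨D, hD⟩
    · refine ⟨[(⟨P, Algebra.subset_adjoin (Or.inl ⟨f, hf⟩)⟩, 1)], fun u v => ?_⟩
      simp [hf, mul_assoc]
    · have hm : P ∈ diffOps 𝕜 E X := Algebra.subset_adjoin (Or.inr ⟨D, hD⟩)
      refine ⟨[(1, ⟨P, hm⟩), (⟨P, hm⟩, 1)], fun u v => ?_⟩
      simp [hD, mul_comm]
  | algebraMap r =>
    refine ⟨[(algebraMap ℝ _ r, 1)], fun u v => ?_⟩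
    simp [Algebra.algebraMap_eq_smul_one]
  | add P Q _ _ hP hQ =>
    obtain ⟨L, hL⟩ := hP
    obtain ⟨M, hM⟩ := hQ
    exact ⟨L ++ M, fun u v => by simp [hL, hM]⟩
  | mul P Q hP' hQ' hP hQ =>
    obtain ⟨L, hL⟩ := hP
    obtain ⟨M, hM⟩ := hQ
    refine ⟨M.flatMap fun R => L.map fun S => (S.1 * R.1, S.2 * R.2), fun u v => ?_⟩
    rw [Module.End.mul_apply, hM]
    clear hM
    induction M with
    | nil => simp
    | cons R M ih =>
      simp only [List.map_cons, List.sum_cons, map_add, List.flatMap_cons, List.map_append,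
        List.sum_append, ih, hL]
      congr 1
      simp [Function.comp_def]

variable (𝕜 E X)

/-- Joint smoothness of a net of functions on `(0, 1] × X`. -/
def JointlySmooth (u : ℝ → X → 𝕜) : Prop :=
  ContMDiffOn (𝓘(ℝ, ℝ).prod 𝓘(ℝ, E)) 𝓘(ℝ, 𝕜) ∞ (fun p : ℝ × X => u p.1 p.2) (Ioc 0 1 ×ˢ univ)

/-- Moderate nets of functions on `X`. -/
def moderate : Subring (ℝ → Smooth 𝕜 E X) where
  carrier := {u | JointlySmooth 𝕜 E X (fun ε => u ε) ∧
    ∀ K : Set X, IsCompact K → ∀ P ∈ diffOps 𝕜 E X,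
      ∃ N : ℕ, UniformBigO 𝕜 X K (fun ε => P (u ε)) fun ε => ε ^ (-(N : ℤ))}
  mul_mem' := by
    rintro u v ⟨hu, hu'⟩ ⟨hv, hv'⟩
    refine ⟨ContMDiffOn.mul hu hv, fun K hK P hP => ?_⟩
    obtain ⟨L, hL⟩ := diffOps_leibniz hP
    simp only [Pi.mul_apply, hL]
    clear hL
    induction L with
    | nil => exact ⟨0, isBigO_zero _ _⟩
    | cons Q L ih =>
      obtain ⟨N, hN⟩ := ih
      obtain ⟨N₁, h₁⟩ := hu' K hK _ Q.1.2
      obtain ⟨N₂, h₂⟩ := hv' K hK _ Q.2.2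
      refine ⟨max (N₁ + N₂) N, ?_⟩
      simp only [List.map_cons, List.sum_cons]
      exact IsBigO.add ((h₁.mul h₂ (zpow_neg_mul_zpow_neg N₁ N₂)).trans
        (isBigO_zpow_neg (le_max_left _ _))) (hN.trans (isBigO_zpow_neg (le_max_right _ _)))
  one_mem' := by
    refine ⟨contMDiffOn_const, fun K hK P _ => ⟨0, uniformBigO_iff.2 ?_⟩⟩
    obtain ⟨C, hC⟩ := hK.exists_bound_of_continuousOn (P 1).contMDiff.continuous.continuousOn
    exact ⟨C, Eventually.of_forall fun ε x hx => by simpa using hC x hx⟩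
  add_mem' := by
    rintro u v ⟨hu, hu'⟩ ⟨hv, hv'⟩
    refine ⟨ContMDiffOn.add hu hv, fun K hK P hP => ?_⟩
    obtain ⟨N, hN⟩ := hu' K hK P hP
    obtain ⟨M, hM⟩ := hv' K hK P hP
    refine ⟨max N M, ?_⟩
    simp only [Pi.add_apply, map_add]
    exact IsBigO.add (hN.trans (isBigO_zpow_neg (le_max_left _ _)))
      (hM.trans (isBigO_zpow_neg (le_max_right _ _)))
  zero_mem' := by
    refine ⟨contMDiffOn_const, fun K hK P _ => ⟨0, ?_⟩⟩
    simp only [Pi.zero_apply, map_zero]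
    exact isBigO_zero _ _
  neg_mem' := by
    rintro u ⟨hu, hu'⟩
    refine ⟨ContMDiffOn.neg hu, fun K hK P hP => ?_⟩
    obtain ⟨N, hN⟩ := hu' K hK P hP
    refine ⟨N, ?_⟩
    simp only [Pi.neg_apply, map_neg]
    exact IsBigO.neg_left hN

/-- A moderate net is `O(ε⁻ᴺ)` on every compact set. -/
theorem moderate_bound (u : moderate 𝕜 E X) {K : Set X} (hK : IsCompact K) :
    ∃ N : ℕ, UniformBigO 𝕜 X K (fun ε => u.1 ε) fun ε => ε ^ (-(N : ℤ)) :=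
  u.2.2 K hK 1 (one_mem _)

/-- Negligible nets of functions on `X`. -/
def negligible : Ideal (moderate 𝕜 E X) where
  carrier := {u | ∀ K : Set X, IsCompact K → ∀ m : ℕ,
    UniformBigO 𝕜 X K (fun ε => u.1 ε) fun ε => ε ^ m}
  add_mem' := fun hu hv K hK m => IsBigO.add (hu K hK m) (hv K hK m)
  zero_mem' := fun _ _ _ => isBigO_zero _ _
  smul_mem' := by
    rintro c u hu K hK m
    obtain ⟨N, hN⟩ := moderate_bound 𝕜 E X c hK
    exact hN.mul (hu K hK (N + m)) (zpow_neg_mul_pow N m)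

/-- The special Colombeau algebra `𝒢(X)`, with smooth dependence on the parameter. -/
def GenFun : Type _ := moderate 𝕜 E X ⧸ negligible 𝕜 E X

instance : CommRing (GenFun 𝕜 E X) :=
  inferInstanceAs (CommRing (moderate 𝕜 E X ⧸ negligible 𝕜 E X))

/-- A constant function on `X`. -/
def constFun (c : 𝕜) : Smooth 𝕜 E X := ContMDiffMap.const c

theorem constFun_eq (c : 𝕜) : constFun 𝕜 E X c =
    RCLike.re c • (1 : Smooth 𝕜 E X) + RCLike.im c • constFun 𝕜 E X RCLike.I := by
  ext x
  change c = RCLike.re c • (1 : 𝕜) + RCLike.im c • RCLike.I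
  rw [RCLike.real_smul_eq_coe_mul, RCLike.real_smul_eq_coe_mul, mul_one, RCLike.re_add_im]

/-- A moderate net of scalars, as a net of constant functions on `X`. -/
def constNet : scalarModerate 𝕜 →+* moderate 𝕜 E X where
  toFun r := ⟨fun ε => constFun 𝕜 E X (r.1 ε), by
    obtain ⟨r, hr, N, hN⟩ := r
    refine ⟨?_, fun K hK P _ => ⟨N, ?_⟩⟩
    · exact ContMDiffOn.comp (t := Ioc (0 : ℝ) 1) (contMDiffOn_iff_contDiffOn.2 hr)
        contMDiffOn_fst fun p hp => hp.1
    · obtain ⟨C₁, h₁⟩ := hK.exists_bound_of_continuousOn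
        (P 1).contMDiff.continuous.continuousOn
      obtain ⟨C₂, h₂⟩ := hK.exists_bound_of_continuousOn
        (P (constFun 𝕜 E X RCLike.I)).contMDiff.continuous.continuousOn
      obtain ⟨C, hC⟩ := isBigO_iff.1 hN
      refine uniformBigO_iff.2 ⟨C * (|C₁| + |C₂|), ?_⟩
      filter_upwards [hC] with ε hε x hx
      rw [constFun_eq, map_add, map_smul, map_smul]
      change ‖RCLike.re (r ε) • (P 1) x + RCLike.im (r ε) • (P (constFun 𝕜 E X RCLike.I)) x‖ ≤ _
      calc _ ≤ |RCLike.re (r ε)| * ‖(P 1) x‖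
            + |RCLike.im (r ε)| * ‖(P (constFun 𝕜 E X RCLike.I)) x‖ := by
            refine (norm_add_le _ _).trans ?_
            rw [norm_smul, norm_smul, Real.norm_eq_abs, Real.norm_eq_abs]
        _ ≤ ‖r ε‖ * |C₁| + ‖r ε‖ * |C₂| := by
            gcongr
            · exact RCLike.abs_re_le_norm _
            · exact (h₁ x hx).trans (le_abs_self _)
            · exact RCLike.abs_im_le_norm _
            · exact (h₂ x hx).trans (le_abs_self _)
        _ = ‖r ε‖ * (|C₁| + |C₂|) := by ring
        _ ≤ C * ‖ε ^ (-(N : ℤ))‖ * (|C₁| + |C₂|) := by gcongr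
        _ = _ := by ring⟩
  map_one' := rfl
  map_mul' _ _ := rfl
  map_zero' := rfl
  map_add' _ _ := rfl

theorem constNet_negligible :
    scalarNegligible 𝕜 ≤ (negligible 𝕜 E X).comap (constNet 𝕜 E X) := by
  intro r hr K _ m
  exact (hr m).comp_tendsto tendsto_fst

/-- `𝒢(X)` is an algebra over the generalized numbers, which act as constant functions. -/
instance : Algebra (GenNumber 𝕜) (GenFun 𝕜 E X) :=
  RingHom.toAlgebra (R := GenNumber 𝕜) (S := GenFun 𝕜 E X)
    (Ideal.quotientMap (negligible 𝕜 E X) (constNet 𝕜 E X) (constNet_negligible 𝕜 E X))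

/-! ### Compactly supported generalized points -/

/-- A compactly supported net of points: smooth on `(0, 1]`, and in a fixed compact set for all
small `ε`. -/
structure CompactNet where
  /-- The underlying net. -/
  toFun : ℝ → X
  contMDiffOn : ContMDiffOn 𝓘(ℝ, ℝ) 𝓘(ℝ, E) ∞ toFun (Ioc 0 1)
  compact : ∃ K : Set X, IsCompact K ∧ ∀ᶠ ε in 𝓝[>] 0, toFun ε ∈ K

variable {E X} in
/-- The value `u(x) = [(u_ε(x_ε))_ε]` of a generalized function at a compactly supported net of
points; it depends only on the class of `(u_ε)_ε` in `𝒢(X)`. -/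
def evalNet (x : CompactNet E X) : GenFun 𝕜 E X →+* GenNumber 𝕜 :=
  Ideal.quotientMap (scalarNegligible 𝕜)
    ({ toFun := fun u => ⟨fun ε => u.1 ε (x.toFun ε), by
          obtain ⟨K, hK, hx⟩ := x.compact
          obtain ⟨N, hN⟩ := moderate_bound 𝕜 E X u hK
          refine ⟨?_, N, hN.comp hx⟩
          rw [← contMDiffOn_iff_contDiffOn]
          exact ContMDiffOn.comp (t := Ioc (0 : ℝ) 1 ×ˢ (univ : Set X)) u.2.1
            (contMDiffOn_id.prodMk x.contMDiffOn) fun ε hε => ⟨hε, mem_univ _⟩⟩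
       map_one' := rfl
       map_mul' := fun _ _ => rfl
       map_zero' := rfl
       map_add' := fun _ _ => rfl } : moderate 𝕜 E X →+* scalarModerate 𝕜)
    (by
      intro u hu m
      obtain ⟨K, hK, hx⟩ := x.compact
      exact (hu K hK m).comp hx)

variable [IsManifold 𝓘(ℝ, E) ∞ X]

/-- Smooth Riemannian metrics on `X`. -/
abbrev RMetric : Type _ :=
  ContMDiffRiemannianMetric 𝓘(ℝ, E) ∞ E (fun x : X => TangentSpace 𝓘(ℝ, E) x)

variable {E X} in
/-- The Riemannian distance of a metric, the infimum of the lengths of the `C¹` paths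
(`∞` between different components). -/
def RMetric.dist (g : RMetric E X) (x y : X) : ℝ≥0∞ :=
  letI : RiemannianBundle (fun x : X => TangentSpace 𝓘(ℝ, E) x) := ⟨g.toRiemannianMetric⟩
  riemannianEDist 𝓘(ℝ, E) x y

variable {E X} in
theorem RMetric.dist_self (g : RMetric E X) (x : X) : g.dist x x = 0 :=
  letI : RiemannianBundle (fun x : X => TangentSpace 𝓘(ℝ, E) x) := ⟨g.toRiemannianMetric⟩
  riemannianEDist_self

variable {E X} in
theorem RMetric.dist_comm (g : RMetric E X) (x y : X) : g.dist x y = g.dist y x :=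
  letI : RiemannianBundle (fun x : X => TangentSpace 𝓘(ℝ, E) x) := ⟨g.toRiemannianMetric⟩
  riemannianEDist_comm

variable {E X} in
theorem RMetric.dist_triangle (g : RMetric E X) (x y z : X) :
    g.dist x z ≤ g.dist x y + g.dist y z :=
  haveI : IsManifold 𝓘(ℝ, E) 1 X := IsManifold.of_le (n := ∞) (by exact_mod_cast le_top)
  letI : RiemannianBundle (fun x : X => TangentSpace 𝓘(ℝ, E) x) := ⟨g.toRiemannianMetric⟩
  riemannianEDist_triangle

/-- Two compactly supported nets of points are equivalent if, for every Riemannian metric, their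
distance is `O(εᵐ)` for all `m`. -/
instance CompactNet.setoid : Setoid (CompactNet E X) where
  r x y := ∀ g : RMetric E X, ∀ m : ℕ, ∃ C : ℝ, ∀ᶠ ε in 𝓝[>] (0 : ℝ),
    g.dist (x.toFun ε) (y.toFun ε) ≤ ENNReal.ofReal (C * ε ^ m)
  iseqv :=
    { refl := fun x g m => ⟨0, Eventually.of_forall fun ε => by
        simp [RMetric.dist_self]⟩
      symm := fun {x y} h g m => by
        obtain ⟨C, hC⟩ := h g m
        refine ⟨C, hC.mono fun ε hε => ?_⟩
        rw [RMetric.dist_comm]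
        exact hε
      trans := fun {x y z} h h' g m => by
        obtain ⟨C, hC⟩ := h g m
        obtain ⟨D, hD⟩ := h' g m
        refine ⟨|C| + |D|, ?_⟩
        filter_upwards [hC, hD, self_mem_nhdsWithin] with ε h1 h2 (hε : 0 < ε)
        rw [add_mul, ENNReal.ofReal_add (by positivity) (by positivity)]
        refine le_trans ?_ (add_le_add (h1.trans ?_) (h2.trans ?_))
        · exact g.dist_triangle _ _ _
        · gcongr; exact le_abs_self _
        · gcongr; exact le_abs_self _ }

/-- The compactly supported generalized points of `X`. -/
abbrev GenPoint : Type _ := Quotient (CompactNet.setoid E X)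

end Manifold

end Colombeau

end

open scoped NNReal

noncomputable section

set_option linter.unusedSectionVars false

namespace Colombeau

/-! A multiplicative functional is recovered from the points where elements of its kernel are small.
Since `ν 1` is idempotent and nets of scalars depend continuously on `ε`, a connectedness argument
gives `ν 1 = 1` (`map_one_of_mul`). Choose a net `a u` representing `ν u`. For a finite set `s`, the
net `v = ∑ |u - a u|² + exp (-1/ε)` is strictly positive and lies in the kernel. If, for some `N`,
every compact set `L` admitted arbitrarily small `ε` with `|v_ε| > εᴺ` on `L`, then a cutoff of
`1/v` in `ε` would be moderate, and `ν` would kill the cutoff, a scalar net equal to `1` along a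
sequence tending to `0` (`false_of_forall_le_norm`). Hence `v` drops below every power of `ε` on
suitable compact sets. Adding an exhaustion function to `s` yields one compact set `K` valid for all
`s`, and minimizers of `v_ε` on `K` form a net `x` with `u(x) - a u` negligible for all `u ∈ s`
(`exists_compact_points`).

This net depends on `s` and need not be continuous. Both defects are cured by finitely many test
functions, the bumps and coordinates of chart patches covering `K`. Their values at `x` agree, up to
negligible errors, with smooth nets, so interpolation in charts gives a smooth net `z` close to `x`
(`exists_smooth_testClose`). The mean value inequality shows that nets not distinguished by the
tests are not distinguished by any moderate net (`TestClose.negl_sub`). For arbitrary `u`, a net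
`x'` adapted to the tests and to `u` is therefore close to `z`, so `ν u = u(z)`.

For uniqueness, Riemannian distance is comparable with coordinate distance on small patches, so
agreement on the tests amounts to negligible distance (`equiv_iff_evalNet_eq`). -/

/-! ### Negligible nets along a filter -/

/-- `r = O(εᵐ)` along `l` for every `m`. -/
def Negl {F : Type*} [Norm F] (l : Filter ℝ) (r : ℝ → F) : Prop :=
  ∀ m : ℕ, r =O[l] fun ε : ℝ => ε ^ m

namespace Negl

variable {F G : Type*} [SeminormedAddCommGroup F] [SeminormedAddCommGroup G] {l l' : Filter ℝ}

theorem mono {r : ℝ → F} (h : Negl l r) (hl : l' ≤ l) : Negl l' r := fun m => (h m).mono hl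

theorem add {r s : ℝ → F} (h : Negl l r) (h' : Negl l s) : Negl l fun ε => r ε + s ε :=
  fun m => (h m).add (h' m)

theorem symm {r s : ℝ → F} (h : Negl l fun ε => r ε - s ε) : Negl l fun ε => s ε - r ε :=
  fun m => (h m).symm

theorem trans {r s t : ℝ → F} (h : Negl l fun ε => r ε - s ε) (h' : Negl l fun ε => s ε - t ε) :
    Negl l fun ε => r ε - t ε := by
  simpa using h.add h'

theorem of_le {r : ℝ → F} {s : ℝ → G} (h : Negl l s) (C : ℝ)
    (hC : ∀ᶠ ε in l, ‖r ε‖ ≤ C * ‖s ε‖) : Negl l r :=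
  fun m => (IsBigO.of_bound C hC).trans (h m)

theorem congr {r s : ℝ → F} (h : Negl l r) (hC : ∀ᶠ ε in l, r ε = s ε) : Negl l s :=
  fun m => (h m).congr' hC EventuallyEq.rfl

theorem eventually_lt {r : ℝ → F} (hl : l ≤ 𝓝[>] 0) (h : Negl l r) {c : ℝ} (hc : 0 < c) :
    ∀ᶠ ε in l, ‖r ε‖ < c := by
  have h0 : Tendsto (fun ε : ℝ => ε ^ 1) l (𝓝 0) := by
    simp only [pow_one]
    exact hl.trans nhdsWithin_le_nhds
  have := (h 1).norm_left.trans_tendsto h0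
  exact this.eventually (gt_mem_nhds hc)

theorem mul_moderate {r : ℝ → F} (hl : l ≤ 𝓝[>] 0) (h : Negl l r) {s : ℝ → G} (C : ℝ) (N : ℕ)
    (hC : ∀ᶠ ε in l, ‖s ε‖ ≤ C * ‖ε ^ (-(N : ℤ))‖ * ‖r ε‖) : Negl l s := by
  intro m
  obtain ⟨D, hD⟩ := (h (N + m)).bound
  refine IsBigO.of_bound (|C| * D) ?_
  filter_upwards [hC, hD, hl (zpow_neg_mul_pow N m)] with ε h1 h2 h3
  calc ‖s ε‖ ≤ C * ‖ε ^ (-(N : ℤ))‖ * ‖r ε‖ := h1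
    _ ≤ |C| * ‖ε ^ (-(N : ℤ))‖ * (D * ‖ε ^ (N + m)‖) := by
        gcongr
        exact le_abs_self C
    _ = |C| * D * ‖ε ^ (-(N : ℤ)) * ε ^ (N + m)‖ := by rw [norm_mul]; ring
    _ = _ := by rw [h3]

/-- Negligibility can be checked on the sets of a finite cover. -/
theorem of_finset_cover {ι : Type*} (t : Finset ι) {A : ι → Set ℝ} {r : ℝ → F}
    (hA : ∀ᶠ ε in l, ∃ i ∈ t, ε ∈ A i) (h : ∀ i ∈ t, Negl (l ⊓ 𝓟 (A i)) r) : Negl l r := by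
  intro m
  have : ∀ i, ∃ C : ℝ, i ∈ t → ∀ᶠ ε in l, ε ∈ A i → ‖r ε‖ ≤ C * ‖ε ^ m‖ := by
    intro i
    by_cases hi : i ∈ t
    · obtain ⟨C, hC⟩ := (h i hi m).bound
      exact ⟨C, fun _ => eventually_inf_principal.1 hC⟩
    · exact ⟨0, fun h => absurd h hi⟩
  choose C hC using this
  refine IsBigO.of_bound (∑ i ∈ t, |C i|) ?_
  filter_upwards [hA, (eventually_all_finset t).2 hC] with ε ⟨i, hi, hε⟩ h2
  refine (h2 i hi hε).trans ?_
  gcongr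
  exact (le_abs_self _).trans (Finset.single_le_sum (f := fun i => |C i|)
    (fun _ _ => abs_nonneg _) hi)

end Negl

/-! ### Chart patches -/

section Patches

variable {𝕜 : Type*} [RCLike 𝕜] {E : Type*} [NormedAddCommGroup E] [NormedSpace ℝ E]
  [FiniteDimensional ℝ E]
  {X : Type*} [TopologicalSpace X] [ChartedSpace E X] {p : X}

/-- The points of the chart domain at `p` with coordinates in the inner ball of `χ`. -/
def chartBall (χ : SmoothBumpFunction 𝓘(ℝ, E) p) : Set X :=
  (extChartAt 𝓘(ℝ, E) p).source ∩
    extChartAt 𝓘(ℝ, E) p ⁻¹' Metric.ball (extChartAt 𝓘(ℝ, E) p p) χ.rIn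

/-- The chart at `p`, cut off to a globally defined map. -/
def chartMap (χ : SmoothBumpFunction 𝓘(ℝ, E) p) (x : X) : E := χ x • extChartAt 𝓘(ℝ, E) p x

/-- A bump function supported in the inner ball of `χ`. -/
def innerBump (χ : SmoothBumpFunction 𝓘(ℝ, E) p) : SmoothBumpFunction 𝓘(ℝ, E) p where
  -- The margin `χ.rIn / 4` below `χ.rIn` leaves room, in `exists_glue_step`, for replacing
  -- coordinates by nearby smooth ones.
  rIn := χ.rIn / 2
  rOut := χ.rIn * (3 / 4)
  rIn_pos := half_pos χ.rIn_pos
  rIn_lt_rOut := by linarith [χ.rIn_pos]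
  closedBall_subset := by
    refine Subset.trans (inter_subset_inter_left _ (Metric.closedBall_subset_closedBall ?_))
      χ.closedBall_subset
    linarith [χ.rIn_pos, χ.rIn_lt_rOut]

theorem closedBall_rOut_subset_target (χ : SmoothBumpFunction 𝓘(ℝ, E) p) :
    Metric.closedBall (extChartAt 𝓘(ℝ, E) p p) χ.rOut ⊆ (extChartAt 𝓘(ℝ, E) p).target := by
  simpa using χ.closedBall_subset

theorem closedBall_rIn_subset_target (χ : SmoothBumpFunction 𝓘(ℝ, E) p) :
    Metric.closedBall (extChartAt 𝓘(ℝ, E) p p) χ.rIn ⊆ (extChartAt 𝓘(ℝ, E) p).target :=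
  (Metric.closedBall_subset_closedBall χ.rIn_lt_rOut.le).trans (closedBall_rOut_subset_target χ)

theorem isOpen_target (p : X) : IsOpen (extChartAt 𝓘(ℝ, E) p).target :=
  isOpen_extChartAt_target p

theorem eq_one_of_mem_chartBall {χ : SmoothBumpFunction 𝓘(ℝ, E) p} {x : X}
    (hx : x ∈ chartBall χ) : χ x = 1 :=
  χ.one_of_dist_le (by simpa using hx.1) (Metric.mem_ball.1 hx.2).le

theorem chartMap_eq {χ : SmoothBumpFunction 𝓘(ℝ, E) p} {x : X} (hx : x ∈ chartBall χ) :
    chartMap χ x = extChartAt 𝓘(ℝ, E) p x := by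
  rw [chartMap, eq_one_of_mem_chartBall hx, one_smul]

theorem mem_ball_of_innerBump_ne_zero {χ : SmoothBumpFunction 𝓘(ℝ, E) p} {x : X}
    (hx : innerBump χ x ≠ 0) : x ∈ (extChartAt 𝓘(ℝ, E) p).source ∧
      extChartAt 𝓘(ℝ, E) p x ∈ Metric.ball (extChartAt 𝓘(ℝ, E) p p) (χ.rIn * (3 / 4)) := by
  have : x ∈ Function.support (innerBump χ) := hx
  rw [SmoothBumpFunction.support_eq_inter_preimage] at this
  exact ⟨by simpa using this.1, this.2⟩

theorem mem_chartBall_of_innerBump_ne_zero {χ : SmoothBumpFunction 𝓘(ℝ, E) p} {x : X}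
    (hx : innerBump χ x ≠ 0) : x ∈ chartBall χ := by
  obtain ⟨h1, h2⟩ := mem_ball_of_innerBump_ne_zero hx
  exact ⟨h1, Metric.ball_subset_ball (by linarith [χ.rIn_pos]) h2⟩

theorem symm_mem_chartBall {χ : SmoothBumpFunction 𝓘(ℝ, E) p} {y : E}
    (hy : y ∈ Metric.ball (extChartAt 𝓘(ℝ, E) p p) χ.rIn) :
    (extChartAt 𝓘(ℝ, E) p).symm y ∈ chartBall χ ∧
      extChartAt 𝓘(ℝ, E) p ((extChartAt 𝓘(ℝ, E) p).symm y) = y := by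
  have ht := closedBall_rIn_subset_target χ (Metric.ball_subset_closedBall hy)
  have h := (extChartAt 𝓘(ℝ, E) p).right_inv ht
  refine ⟨⟨(extChartAt 𝓘(ℝ, E) p).map_target ht, ?_⟩, h⟩
  rw [mem_preimage, h]
  exact hy

/-- A compact set is covered by finitely many sets on which the inner bump functions are `1`. -/
theorem exists_finset_innerBump_eq_one (χ : ∀ p : X, SmoothBumpFunction 𝓘(ℝ, E) p) {K : Set X}
    (hK : IsCompact K) : ∃ t : Finset X, ∀ x ∈ K, ∃ p ∈ t, innerBump (χ p) x = 1 := by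
  obtain ⟨t, -, ht⟩ := hK.elim_nhds_subcover (fun p => {x | innerBump (χ p) x = 1})
    fun p _ => (innerBump (χ p)).eventuallyEq_one
  exact ⟨t, fun x hx => by simpa using ht hx⟩

/-! ### Lipschitz estimates in chart patches. -/

section Calculus

variable [T2Space X] [IsManifold 𝓘(ℝ, E) ∞ X]

theorem contMDiff_chartMap (χ : SmoothBumpFunction 𝓘(ℝ, E) p) :
    ContMDiff 𝓘(ℝ, E) 𝓘(ℝ, E) ∞ (chartMap χ) :=
  χ.contMDiff_smul contMDiffOn_extChartAt

variable {F : Type*} [NormedAddCommGroup F] [NormedSpace ℝ F]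

theorem contDiffOn_comp_symm {f : X → F} (hf : ContMDiff 𝓘(ℝ, E) 𝓘(ℝ, F) ∞ f) (p : X) :
    ContDiffOn ℝ ∞ (f ∘ (extChartAt 𝓘(ℝ, E) p).symm) (extChartAt 𝓘(ℝ, E) p).target :=
  contMDiffOn_iff_contDiffOn.1 (hf.comp_contMDiffOn (contMDiffOn_extChartAt_symm p))

/-- A derivative bound in coordinates gives a Lipschitz estimate on the chart ball. -/
theorem norm_sub_le_of_fderiv_le {f : X → F} (hf : ContMDiff 𝓘(ℝ, E) 𝓘(ℝ, F) ∞ f)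
    (χ : SmoothBumpFunction 𝓘(ℝ, E) p) {M : ℝ}
    (hM : ∀ y ∈ Metric.ball (extChartAt 𝓘(ℝ, E) p p) χ.rIn,
      ‖fderiv ℝ (f ∘ (extChartAt 𝓘(ℝ, E) p).symm) y‖ ≤ M)
    {x y : X} (hx : x ∈ chartBall χ) (hy : y ∈ chartBall χ) :
    ‖f x - f y‖ ≤ M * ‖extChartAt 𝓘(ℝ, E) p x - extChartAt 𝓘(ℝ, E) p y‖ := by
  have h := (convex_ball (extChartAt 𝓘(ℝ, E) p p) χ.rIn).norm_image_sub_le_of_norm_fderiv_le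
    (𝕜 := ℝ) (f := f ∘ (extChartAt 𝓘(ℝ, E) p).symm) (C := M) (fun z hz => ?_) hM hy.2 hx.2
  · simpa [(extChartAt 𝓘(ℝ, E) p).left_inv hx.1, (extChartAt 𝓘(ℝ, E) p).left_inv hy.1,
      -extChartAt] using h
  · have hz' := closedBall_rIn_subset_target χ (Metric.ball_subset_closedBall hz)
    exact ((contDiffOn_comp_symm hf p).contDiffAt ((isOpen_target p).mem_nhds hz')).differentiableAt
      (by simp)

theorem negl_sub_of_contMDiff {f : X → F} (hf : ContMDiff 𝓘(ℝ, E) 𝓘(ℝ, F) ∞ f)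
    (χ : SmoothBumpFunction 𝓘(ℝ, E) p) {l : Filter ℝ} {x y : ℝ → X}
    (hx : ∀ᶠ ε in l, x ε ∈ chartBall χ) (hy : ∀ᶠ ε in l, y ε ∈ chartBall χ)
    (h : Negl l fun ε => extChartAt 𝓘(ℝ, E) p (x ε) - extChartAt 𝓘(ℝ, E) p (y ε)) :
    Negl l fun ε => f (x ε) - f (y ε) := by
  have hc : ContinuousOn (fun y => fderiv ℝ (f ∘ (extChartAt 𝓘(ℝ, E) p).symm) y)
      (Metric.closedBall (extChartAt 𝓘(ℝ, E) p p) χ.rIn) :=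
    ((contDiffOn_comp_symm hf p).continuousOn_fderiv_of_isOpen (isOpen_target p) (by simp)).mono
      (closedBall_rIn_subset_target χ)
  obtain ⟨M, hM⟩ := (isCompact_closedBall _ _).exists_bound_of_continuousOn hc
  refine h.of_le M ?_
  filter_upwards [hx, hy] with ε h1 h2
  exact norm_sub_le_of_fderiv_le hf χ (fun z hz => hM z (Metric.ball_subset_closedBall hz)) h1 h2

theorem differentiableAt_comp_symm {f : X → F} (hf : ContMDiff 𝓘(ℝ, E) 𝓘(ℝ, F) ∞ f) {x : X}
    (hx : x ∈ (extChartAt 𝓘(ℝ, E) p).source) :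
    DifferentiableAt ℝ (f ∘ (extChartAt 𝓘(ℝ, E) p).symm) (extChartAt 𝓘(ℝ, E) p x) :=
  ((contDiffOn_comp_symm hf p).contDiffAt ((isOpen_target p).mem_nhds
    ((extChartAt 𝓘(ℝ, E) p).map_source hx))).differentiableAt (by simp)

theorem mem_source_of_ne_zero {χ : SmoothBumpFunction 𝓘(ℝ, E) p} {x : X} (hx : χ x ≠ 0) :
    x ∈ (extChartAt 𝓘(ℝ, E) p).source := by
  simpa using χ.support_subset_source hx

/-- The derivative in the coordinate direction `v`, cut off by `χ`. -/
def coordDeriv (χ : SmoothBumpFunction 𝓘(ℝ, E) p) (v : E) :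
    Derivation ℝ (Smooth 𝕜 E X) (Smooth 𝕜 E X) :=
  Derivation.mk'
    { toFun := fun u => ⟨fun x => χ x •
          fderiv ℝ (u ∘ (extChartAt 𝓘(ℝ, E) p).symm) (extChartAt 𝓘(ℝ, E) p x) v, by
        refine χ.contMDiff_smul ?_
        have h : ContDiffOn ℝ ∞ (fun y => fderiv ℝ (u ∘ (extChartAt 𝓘(ℝ, E) p).symm) y v)
            (extChartAt 𝓘(ℝ, E) p).target :=
          ((contDiffOn_comp_symm u.contMDiff p).fderiv_of_isOpen (isOpen_target p)
            (by simp)).clm_apply contDiffOn_const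
        refine (contMDiffOn_iff_contDiffOn.2 h).comp contMDiffOn_extChartAt fun x hx => ?_
        exact (extChartAt 𝓘(ℝ, E) p).map_source (by simpa using hx)⟩
      map_add' := fun u w => by
        ext x
        change χ x • fderiv ℝ (u ∘ (extChartAt 𝓘(ℝ, E) p).symm +
            w ∘ (extChartAt 𝓘(ℝ, E) p).symm) (extChartAt 𝓘(ℝ, E) p x) v =
          χ x • fderiv ℝ (u ∘ (extChartAt 𝓘(ℝ, E) p).symm) (extChartAt 𝓘(ℝ, E) p x) v +
          χ x • fderiv ℝ (w ∘ (extChartAt 𝓘(ℝ, E) p).symm) (extChartAt 𝓘(ℝ, E) p x) v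
        -- Differentiability of the coordinate expressions is known only over the chart domain;
        -- where it could fail, the factor `χ x` makes both sides vanish.
        by_cases h : χ x = 0
        · simp only [h, zero_smul, add_zero]
        · have hx := mem_source_of_ne_zero h
          rw [fderiv_add (differentiableAt_comp_symm u.contMDiff hx)
            (differentiableAt_comp_symm w.contMDiff hx), ← smul_add]
          rfl
      map_smul' := fun r u => by
        ext x
        change χ x • fderiv ℝ (r • (u ∘ (extChartAt 𝓘(ℝ, E) p).symm))
            (extChartAt 𝓘(ℝ, E) p x) v =
          r • χ x • fderiv ℝ (u ∘ (extChartAt 𝓘(ℝ, E) p).symm) (extChartAt 𝓘(ℝ, E) p x) v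
        by_cases h : χ x = 0
        · simp only [h, zero_smul, smul_zero]
        · have hx := mem_source_of_ne_zero h
          rw [fderiv_const_smul (differentiableAt_comp_symm u.contMDiff hx), smul_comm r]
          rfl }
    (fun u w => by
      ext x
      change χ x • fderiv ℝ ((u ∘ (extChartAt 𝓘(ℝ, E) p).symm) *
            (w ∘ (extChartAt 𝓘(ℝ, E) p).symm)) (extChartAt 𝓘(ℝ, E) p x) v =
          u x * (χ x • fderiv ℝ (w ∘ (extChartAt 𝓘(ℝ, E) p).symm) (extChartAt 𝓘(ℝ, E) p x) v) +
          w x * (χ x • fderiv ℝ (u ∘ (extChartAt 𝓘(ℝ, E) p).symm) (extChartAt 𝓘(ℝ, E) p x) v)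
      by_cases h : χ x = 0
      · simp only [h, zero_smul, mul_zero, add_zero]
      · have hx := mem_source_of_ne_zero h
        rw [fderiv_mul (differentiableAt_comp_symm u.contMDiff hx)
          (differentiableAt_comp_symm w.contMDiff hx), mul_smul_comm, mul_smul_comm, ← smul_add]
        simp only [Function.comp_apply, (extChartAt 𝓘(ℝ, E) p).left_inv hx]
        rfl)

theorem coordDeriv_mem_diffOps (χ : SmoothBumpFunction 𝓘(ℝ, E) p) (v : E) :
    (coordDeriv (𝕜 := 𝕜) χ v : Module.End ℝ (Smooth 𝕜 E X)) ∈ diffOps 𝕜 E X :=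
  Algebra.subset_adjoin (Or.inr ⟨coordDeriv χ v, fun _ => rfl⟩)

/-- On the chart ball `χ = 1`, so the globally defined derivations `coordDeriv χ (b i)` are the true
partial derivatives there, and moderateness bounds each of them. A finite basis then controls the
operator norm. -/
theorem exists_fderiv_bound (χ : SmoothBumpFunction 𝓘(ℝ, E) p) (u : moderate 𝕜 E X) :
    ∃ (C : ℝ) (N : ℕ), ∀ᶠ ε in 𝓝[>] (0 : ℝ),
      ∀ y ∈ Metric.ball (extChartAt 𝓘(ℝ, E) p p) χ.rIn,
        ‖fderiv ℝ (u.1 ε ∘ (extChartAt 𝓘(ℝ, E) p).symm) y‖ ≤ C * ‖ε ^ (-(N : ℤ))‖ := by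
  have hK : IsCompact ((extChartAt 𝓘(ℝ, E) p).symm ''
      Metric.closedBall (extChartAt 𝓘(ℝ, E) p p) χ.rIn) :=
    (isCompact_closedBall _ _).image_of_continuousOn
      ((continuousOn_extChartAt_symm p).mono (closedBall_rIn_subset_target χ))
  let b := Module.finBasis ℝ E
  have h : ∀ i, ∃ N : ℕ, ∃ C : ℝ, ∀ᶠ ε in 𝓝[>] (0 : ℝ),
      ∀ y ∈ Metric.ball (extChartAt 𝓘(ℝ, E) p p) χ.rIn,
        ‖fderiv ℝ (u.1 ε ∘ (extChartAt 𝓘(ℝ, E) p).symm) y (b i)‖ ≤ C * ‖ε ^ (-(N : ℤ))‖ := by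
    intro i
    obtain ⟨N, hN⟩ := u.2.2 _ hK _ (coordDeriv_mem_diffOps χ (b i))
    obtain ⟨C, hC⟩ := uniformBigO_iff.1 hN
    refine ⟨N, C, hC.mono fun ε hε y hy => ?_⟩
    have := hε _ (mem_image_of_mem _ (Metric.ball_subset_closedBall hy))
    obtain ⟨h1, h2⟩ := symm_mem_chartBall hy
    change ‖χ _ • fderiv ℝ (u.1 ε ∘ (extChartAt 𝓘(ℝ, E) p).symm)
      (extChartAt 𝓘(ℝ, E) p _) (b i)‖ ≤ _ at this
    rwa [eq_one_of_mem_chartBall h1, one_smul, h2] at this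
  choose N C hC using h
  obtain ⟨D, hD, hD'⟩ := b.exists_opNorm_le (F := 𝕜)
  refine ⟨D * ∑ i, |C i|, ∑ i, N i, ?_⟩
  filter_upwards [eventually_all.2 hC, Ioc_mem_nhdsGT (zero_lt_one : (0 : ℝ) < 1)] with ε h1 hε y hy
  rw [mul_assoc]
  refine hD' (by positivity) fun i => (h1 i y hy).trans ?_
  gcongr ?_ * ?_
  · exact (le_abs_self _).trans (Finset.single_le_sum (f := fun i => |C i|)
      (fun _ _ => abs_nonneg _) (Finset.mem_univ i))
  · rw [Real.norm_of_nonneg (zpow_nonneg hε.1.le _), Real.norm_of_nonneg (zpow_nonneg hε.1.le _)]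
    refine zpow_le_zpow_right_of_le_one₀ hε.1 hε.2 ?_
    have := Finset.single_le_sum (f := N) (fun _ _ => Nat.zero_le _) (Finset.mem_univ i)
    omega

/-- The Lipschitz constant of `u_ε` may grow like `ε⁻ᴺ`, but a negligible coordinate difference
absorbs any such factor. -/
theorem negl_sub_of_moderate (u : moderate 𝕜 E X) (χ : SmoothBumpFunction 𝓘(ℝ, E) p)
    {l : Filter ℝ} (hl : l ≤ 𝓝[>] 0) {x y : ℝ → X}
    (hx : ∀ᶠ ε in l, x ε ∈ chartBall χ) (hy : ∀ᶠ ε in l, y ε ∈ chartBall χ)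
    (h : Negl l fun ε => extChartAt 𝓘(ℝ, E) p (x ε) - extChartAt 𝓘(ℝ, E) p (y ε)) :
    Negl l fun ε => u.1 ε (x ε) - u.1 ε (y ε) := by
  obtain ⟨C, N, hC⟩ := exists_fderiv_bound χ u
  refine h.mul_moderate hl C N ?_
  filter_upwards [hx, hy, hl hC] with ε h1 h2 h3
  exact norm_sub_le_of_fderiv_le (u.1 ε).contMDiff χ h3 h1 h2

theorem eventually_mem_chartBall {χ : SmoothBumpFunction 𝓘(ℝ, E) p} {l : Filter ℝ}
    (hl : l ≤ 𝓝[>] 0) {x y : ℝ → X} {c : ℝ} (hc : 0 < c)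
    (hx : ∀ᶠ ε in l, c ≤ innerBump χ (x ε))
    (h1 : Negl l fun ε => innerBump χ (x ε) - innerBump χ (y ε)) :
    ∀ᶠ ε in l, c / 2 < innerBump χ (y ε) := by
  filter_upwards [hx, h1.eventually_lt hl (half_pos hc)] with ε h h'
  rw [Real.norm_eq_abs] at h'
  linarith [(abs_lt.1 h').2]

theorem negl_extChartAt_sub {χ : SmoothBumpFunction 𝓘(ℝ, E) p} {l : Filter ℝ} {x y : ℝ → X}
    (hx : ∀ᶠ ε in l, x ε ∈ chartBall χ) (hy : ∀ᶠ ε in l, y ε ∈ chartBall χ)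
    (h : Negl l fun ε => chartMap χ (x ε) - chartMap χ (y ε)) :
    Negl l fun ε => extChartAt 𝓘(ℝ, E) p (x ε) - extChartAt 𝓘(ℝ, E) p (y ε) := by
  refine h.congr ?_
  filter_upwards [hx, hy] with ε h1 h2
  rw [chartMap_eq h1, chartMap_eq h2]

/-- The test functions of the patches `χ p`, `p ∈ t`, do not distinguish `x` and `y`. -/
def TestClose (χ : ∀ p : X, SmoothBumpFunction 𝓘(ℝ, E) p) (t : Finset X) (l : Filter ℝ)
    (x y : ℝ → X) : Prop :=
  ∀ p ∈ t, (Negl l fun ε => innerBump (χ p) (x ε) - innerBump (χ p) (y ε)) ∧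
    Negl l fun ε => chartMap (χ p) (x ε) - chartMap (χ p) (y ε)

/-- Where the bump at `p` equals `1` on `x`, it is eventually above `1/2` on `y`. Both points then
lie in the region where `chartMap` is the chart itself, so the second test is the coordinate
difference. -/
theorem TestClose.chart {χ : ∀ p : X, SmoothBumpFunction 𝓘(ℝ, E) p} {t : Finset X}
    {x y : ℝ → X} (h : TestClose χ t (𝓝[>] 0) x y) {p : X} (hp : p ∈ t) :
    (∀ᶠ ε in 𝓝[>] 0 ⊓ 𝓟 {ε | innerBump (χ p) (x ε) = 1}, x ε ∈ chartBall (χ p)) ∧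
    (∀ᶠ ε in 𝓝[>] 0 ⊓ 𝓟 {ε | innerBump (χ p) (x ε) = 1}, y ε ∈ chartBall (χ p)) ∧
    Negl (𝓝[>] 0 ⊓ 𝓟 {ε | innerBump (χ p) (x ε) = 1})
      fun ε => extChartAt 𝓘(ℝ, E) p (x ε) - extChartAt 𝓘(ℝ, E) p (y ε) := by
  have h1 : ∀ᶠ ε in 𝓝[>] 0 ⊓ 𝓟 {ε | innerBump (χ p) (x ε) = 1}, innerBump (χ p) (x ε) = 1 :=
    mem_inf_of_right (mem_principal_self _)
  have hx : ∀ᶠ ε in 𝓝[>] 0 ⊓ 𝓟 {ε | innerBump (χ p) (x ε) = 1}, x ε ∈ chartBall (χ p) :=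
    h1.mono fun ε hε => mem_chartBall_of_innerBump_ne_zero (by rw [hε]; exact one_ne_zero)
  have hy := (eventually_mem_chartBall inf_le_left one_pos (h1.mono fun ε hε => hε.ge)
    ((h p hp).1.mono inf_le_left)).mono fun ε hε =>
      mem_chartBall_of_innerBump_ne_zero (χ := χ p) (x := y ε) (by linarith : (0:ℝ) < _).ne'
  exact ⟨hx, hy, negl_extChartAt_sub hx hy ((h p hp).2.mono inf_le_left)⟩

/-- Each small `ε` belongs to one of finitely many parameter sets on which a single chart contains
both nets, so the local Lipschitz estimates combine. -/
theorem TestClose.negl_sub {χ : ∀ p : X, SmoothBumpFunction 𝓘(ℝ, E) p} {t : Finset X}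
    {x y : ℝ → X} (h : TestClose χ t (𝓝[>] 0) x y)
    (hx : ∀ᶠ ε in 𝓝[>] 0, ∃ p ∈ t, innerBump (χ p) (x ε) = 1) (u : moderate 𝕜 E X) :
    Negl (𝓝[>] 0) fun ε => u.1 ε (x ε) - u.1 ε (y ε) := by
  refine Negl.of_finset_cover t hx fun p hp => ?_
  obtain ⟨h1, h2, h3⟩ := h.chart hp
  exact negl_sub_of_moderate u (χ p) inf_le_left h1 h2 h3

end Calculus

end Patches

/-! ### Riemannian metrics -/

section Riemannian

variable {E : Type*} [NormedAddCommGroup E] [NormedSpace ℝ E]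
  [FiniteDimensional ℝ E]
  {X : Type*} [TopologicalSpace X] [ChartedSpace E X] [T2Space X]
  [IsManifold 𝓘(ℝ, E) ∞ X]

/-- A positive definite symmetric bilinear form on a finite dimensional space. -/
def euclideanForm (E : Type*) [NormedAddCommGroup E] [NormedSpace ℝ E] [FiniteDimensional ℝ E] :
    E →L[ℝ] E →L[ℝ] ℝ :=
  (innerSL ℝ).bilinearComp (toEuclidean (E := E)).toContinuousLinearMap
    (toEuclidean (E := E)).toContinuousLinearMap

theorem euclideanForm_apply (v w : E) :
    euclideanForm E v w = inner ℝ (toEuclidean v) (toEuclidean w) := rfl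

theorem euclideanForm_pos {v : E} (hv : v ≠ 0) : 0 < euclideanForm E v v := by
  rw [euclideanForm_apply, real_inner_self_pos]
  simpa using hv

/-- The form `euclideanForm`, transported to the tangent spaces near `p` by the chart at `p`. -/
def localForm (p x : X) :
    TangentSpace 𝓘(ℝ, E) x →L[ℝ] TangentSpace 𝓘(ℝ, E) x →L[ℝ] ℝ :=
  ((ContinuousLinearMap.precomp ℝ
    ((trivializationAt E (TangentSpace 𝓘(ℝ, E)) p).continuousLinearMapAt ℝ x)).comp
    (euclideanForm E)).comp
      ((trivializationAt E (TangentSpace 𝓘(ℝ, E)) p).continuousLinearMapAt ℝ x)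

-- Read in the trivialization at `p`, the section is the constant `euclideanForm E`.
set_option synthInstance.maxHeartbeats 400000 in
set_option maxHeartbeats 1000000 in
theorem contMDiffOn_localForm (p : X) :
    ContMDiffOn 𝓘(ℝ, E) (𝓘(ℝ, E).prod 𝓘(ℝ, E →L[ℝ] E →L[ℝ] ℝ)) ∞
      (fun x => TotalSpace.mk' (E →L[ℝ] E →L[ℝ] ℝ)
        (E := fun x : X => TangentSpace 𝓘(ℝ, E) x →L[ℝ] TangentSpace 𝓘(ℝ, E) x →L[ℝ] ℝ)
        x (localForm p x))
      (trivializationAt E (TangentSpace 𝓘(ℝ, E)) p).baseSet := by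
  refine (Trivialization.contMDiffOn_section_iff (trivializationAt (E →L[ℝ] E →L[ℝ] ℝ)
    (fun x : X => TangentSpace 𝓘(ℝ, E) x →L[ℝ] TangentSpace 𝓘(ℝ, E) x →L[ℝ] ℝ) p)
    (Trivialization.open_baseSet _) (fun x hx => ?_)).2 ?_
  · exact ⟨hx, hx, mem_univ x⟩
  refine ContMDiffOn.congr (contMDiffOn_const (c := euclideanForm E)) fun x hx => ?_
  ext v w
  simp [hom_trivializationAt_apply, ContinuousLinearMap.inCoordinates, localForm]
  have hx' : x ∈ (trivializationAt (E →L[ℝ] ℝ)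
      (fun x : X => TangentSpace 𝓘(ℝ, E) x →L[ℝ] ℝ) p).baseSet := ⟨hx, mem_univ x⟩
  rw [Trivialization.coe_linearMapAt_of_mem _ hx']
  simp [hom_trivializationAt_apply, ContinuousLinearMap.inCoordinates]
  have h : ∀ v : E, (trivializationAt E (TangentSpace 𝓘(ℝ, E)) p).continuousLinearMapAt ℝ x
      ((trivializationAt E (TangentSpace 𝓘(ℝ, E)) p).symmL ℝ x v) = v :=
    (trivializationAt E (TangentSpace 𝓘(ℝ, E)) p).continuousLinearMapAt_symmL hx
  exact congrArg₂ (fun a b => euclideanForm E a b) (h v) (h w)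

theorem localForm_apply (p x : X) (v w : TangentSpace 𝓘(ℝ, E) x) : localForm p x v w =
    euclideanForm E
      ((trivializationAt E (TangentSpace 𝓘(ℝ, E)) p).continuousLinearMapAt ℝ x v)
      ((trivializationAt E (TangentSpace 𝓘(ℝ, E)) p).continuousLinearMapAt ℝ x w) := rfl

theorem localForm_symm (p x : X) (v w : TangentSpace 𝓘(ℝ, E) x) :
    localForm p x v w = localForm p x w v := by
  rw [localForm_apply, localForm_apply, euclideanForm_apply, euclideanForm_apply,
    real_inner_comm]

theorem localForm_pos {p x : X}
    (hx : x ∈ (trivializationAt E (TangentSpace 𝓘(ℝ, E)) p).baseSet)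
    (v : TangentSpace 𝓘(ℝ, E) x) (hv : v ≠ 0) : 0 < localForm p x v v := by
  rw [localForm_apply]
  refine euclideanForm_pos fun h => hv ?_
  have h' := (trivializationAt E (TangentSpace 𝓘(ℝ, E)) p).symmL_continuousLinearMapAt
    (R := ℝ) hx v
  rw [h, map_zero] at h'
  exact h'.symm

-- Compactness of the unit sphere bounds `1 / B v v` there, and homogeneity turns this into `‖v‖² ≤
-- |C| * B v v`.
set_option synthInstance.maxHeartbeats 400000 in
theorem isVonNBounded_of_pos {B : E →L[ℝ] E →L[ℝ] ℝ} (hB : ∀ v ≠ 0, 0 < B v v) :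
    Bornology.IsVonNBounded ℝ {v : E | B v v < 1} := by
  rw [NormedSpace.isVonNBounded_iff, isBounded_iff_forall_norm_le]
  have hc : ContinuousOn (fun v : E => (B v v)⁻¹) (Metric.sphere 0 1) := by
    refine ContinuousOn.inv₀ (by fun_prop) fun v hv => (hB v ?_).ne'
    rintro rfl
    simp at hv
  obtain ⟨C, hC⟩ := (isCompact_sphere (0 : E) 1).exists_bound_of_continuousOn hc
  refine ⟨|C| + 1, fun v (hv : B v v < 1) => ?_⟩
  by_cases h0 : v = 0
  · rw [h0, norm_zero]
    positivity
  · have hn : 0 < ‖v‖ := norm_pos_iff.2 h0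
    have h1 := hC (‖v‖⁻¹ • v) (by simp [norm_smul, hn.ne'])
    have h2 := hB v h0
    simp only [map_smul, smul_apply, smul_eq_mul, mul_inv, inv_inv,
      norm_mul, norm_norm, norm_inv, Real.norm_of_nonneg h2.le] at h1
    have h3 : ‖v‖ * ‖v‖ ≤ |C| := by
      calc ‖v‖ * ‖v‖ = ‖v‖ * (‖v‖ * (B v v)⁻¹) * B v v := by field_simp
        _ ≤ C * B v v := by gcongr
        _ ≤ |C| * 1 := by
          gcongr
          exact le_abs_self C
        _ = |C| := mul_one _
    nlinarith [abs_nonneg C]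

-- Positive definite symmetric forms make up a convex set in each fibre, so the local forms can be
-- glued by a partition of unity.
variable (E X) in
set_option synthInstance.maxHeartbeats 400000 in
set_option maxHeartbeats 1000000 in
theorem nonempty_rMetric [SecondCountableTopology X] : Nonempty (RMetric E X) := by
  have : LocallyCompactSpace X := ChartedSpace.locallyCompactSpace E X
  let t : ∀ x : X, Set (TangentSpace 𝓘(ℝ, E) x →L[ℝ] TangentSpace 𝓘(ℝ, E) x →L[ℝ] ℝ) :=
    fun x => {B | (∀ v w, B v w = B w v) ∧ ∀ v, v ≠ 0 → 0 < B v v}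
  have hconv : ∀ x, Convex ℝ (t x) := by
    intro x B hB C hC a b ha hb hab
    refine ⟨fun v w => ?_, fun v hv => ?_⟩
    · change a * B v w + b * C v w = a * B w v + b * C w v
      rw [hB.1 v w, hC.1 v w]
    · have h1 := hB.2 v hv
      have h2 := hC.2 v hv
      change 0 < a * B v v + b * C v v
      rcases ha.eq_or_lt with rfl | ha
      · rw [zero_add] at hab
        simpa [hab] using h2
      · positivity
  have hloc : ∀ p : X, ∀ x ∈ (trivializationAt E (TangentSpace 𝓘(ℝ, E)) p).baseSet,
      localForm p x ∈ t x := fun p x hx => ⟨localForm_symm p x, localForm_pos hx⟩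
  obtain ⟨s, hs⟩ := exists_contMDiffSection_forall_mem_convex_of_local (I := 𝓘(ℝ, E))
    (n := (⊤ : ℕ∞)) (F_fiber := E →L[ℝ] E →L[ℝ] ℝ)
    (fun x : X => TangentSpace 𝓘(ℝ, E) x →L[ℝ] TangentSpace 𝓘(ℝ, E) x →L[ℝ] ℝ) t hconv
    (fun p => ⟨_, (trivializationAt E (TangentSpace 𝓘(ℝ, E)) p).open_baseSet.mem_nhds
      (FiberBundle.mem_baseSet_trivializationAt' p), localForm p, contMDiffOn_localForm p, hloc p⟩)
  exact ⟨{ inner := fun x => s x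
           symm := fun x => (hs x).1
           pos := fun x => (hs x).2
           isVonNBounded := fun x => isVonNBounded_of_pos (E := E) (hs x).2
           contMDiff := s.contMDiff }⟩

/-! ### Comparison of Riemannian distance with coordinate distance. -/

section Bounds

variable [RiemannianBundle (fun x : X => TangentSpace 𝓘(ℝ, E) x)]
  [IsContinuousRiemannianBundle E (fun x : X => TangentSpace 𝓘(ℝ, E) x)]

attribute [local instance] normedAddCommGroupTangentSpaceVectorSpace
  normedSpaceTangentSpaceVectorSpace

/-- The inverse chart has bounded derivative near `p`, and `χ` is chosen with support in that
region. Its inner ball is convex, so coordinate segments lift to paths whose length is at most `C`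
times the coordinate distance. -/
theorem exists_riemannianEDist_le_edist (p : X) :
    ∃ (C : ℝ≥0) (χ : SmoothBumpFunction 𝓘(ℝ, E) p), ∀ x ∈ chartBall χ, ∀ y ∈ chartBall χ,
      riemannianEDist 𝓘(ℝ, E) x y ≤
        C * edist (extChartAt 𝓘(ℝ, E) p x) (extChartAt 𝓘(ℝ, E) p y) := by
  have : IsManifold 𝓘(ℝ, E) 1 X := IsManifold.of_le (n := ∞) (by exact_mod_cast le_top)
  obtain ⟨C, -, hC⟩ := eventually_enorm_mfderivWithin_symm_extChartAt_lt 𝓘(ℝ, E) p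
  rw [ModelWithCorners.range_eq_univ, nhdsWithin_univ] at hC
  have hC' : ∀ᶠ x in 𝓝 p, ∀ w : TangentSpace 𝓘(ℝ, E) (extChartAt 𝓘(ℝ, E) p x),
      ‖mfderivWithin 𝓘(ℝ, E) 𝓘(ℝ, E) (extChartAt 𝓘(ℝ, E) p).symm univ
        (extChartAt 𝓘(ℝ, E) p x) w‖ₑ ≤ C * ‖w‖ₑ := by
    filter_upwards [(continuousAt_extChartAt (I := 𝓘(ℝ, E)) p).eventually hC] with x hx w
    refine (ContinuousLinearMap.le_opENorm _ _).trans ?_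
    gcongr
    exact hx.le
  obtain ⟨χ, -, hχ⟩ := (SmoothBumpFunction.nhds_basis_support (I := 𝓘(ℝ, E)) (c := p)
    univ_mem).mem_iff.1 hC'
  refine ⟨C, χ, fun x hx y hy => ?_⟩
  let η := ContinuousAffineMap.lineMap (R := ℝ) (extChartAt 𝓘(ℝ, E) p x)
    (extChartAt 𝓘(ℝ, E) p y)
  set γ := (extChartAt 𝓘(ℝ, E) p).symm ∘ η
  have hη : Icc 0 1 ⊆ ⇑η ⁻¹' ((extChartAt 𝓘(ℝ, E) p).target ∩
      {y | ∀ w : TangentSpace 𝓘(ℝ, E) y,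
        ‖mfderivWithin 𝓘(ℝ, E) 𝓘(ℝ, E) (extChartAt 𝓘(ℝ, E) p).symm univ y w‖ₑ ≤
          C * ‖w‖ₑ}) := by
    simp only [← image_subset_iff, ContinuousAffineMap.coe_lineMap_eq,
      ← segment_eq_image_lineMap, η]
    refine ((convex_ball _ _).segment_subset hx.2 hy.2).trans fun z hz => ?_
    have ht := closedBall_rIn_subset_target χ (Metric.ball_subset_closedBall hz)
    refine ⟨ht, ?_⟩
    obtain ⟨h1, h2⟩ := symm_mem_chartBall hz
    have h3 := hχ (show (extChartAt 𝓘(ℝ, E) p).symm z ∈ Function.support χ by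
      rw [Function.mem_support, eq_one_of_mem_chartBall h1]
      exact one_ne_zero)
    simp only [mem_ofPred_eq] at h3
    rwa [h2] at h3
  simp only [preimage_inter, subset_inter_iff] at hη
  have η_smooth : ContMDiffOn 𝓘(ℝ, ℝ) 𝓘(ℝ, E) 1 η (Icc 0 1) := by
    apply ContMDiff.contMDiffOn
    rw [contMDiff_iff_contDiff]
    exact ContinuousAffineMap.contDiff _
  have : riemannianEDist 𝓘(ℝ, E) x y ≤ pathELength 𝓘(ℝ, E) γ 0 1 := by
    apply riemannianEDist_le_pathELength _ _ _ zero_le_one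
    · exact (contMDiffOn_extChartAt_symm p).comp η_smooth hη.1
    · simpa [γ, η, ContinuousAffineMap.coe_lineMap_eq, -extChartAt] using
        (extChartAt 𝓘(ℝ, E) p).left_inv hx.1
    · simpa [γ, η, ContinuousAffineMap.coe_lineMap_eq, -extChartAt] using
        (extChartAt 𝓘(ℝ, E) p).left_inv hy.1
  apply this.trans
  rw [← lintegral_fderiv_lineMap_eq_edist, pathELength_eq_lintegral_mfderivWithin_Icc,
    ← MeasureTheory.lintegral_const_mul' _ _ ENNReal.coe_ne_top]
  apply MeasureTheory.setLIntegral_mono' measurableSet_Icc (fun t ht ↦ ?_)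
  have : mfderivWithin 𝓘(ℝ, ℝ) 𝓘(ℝ, E) γ (Icc 0 1) t =
      (mfderivWithin 𝓘(ℝ, E) 𝓘(ℝ, E) (extChartAt 𝓘(ℝ, E) p).symm univ (η t)) ∘L
        (mfderivWithin 𝓘(ℝ, ℝ) 𝓘(ℝ, E) η (Icc 0 1) t) := by
    apply mfderivWithin_comp
    · simpa using mdifferentiableWithinAt_extChartAt_symm (I := 𝓘(ℝ, E)) (hη.1 ht)
    · exact η_smooth.mdifferentiableOn one_ne_zero t ht
    · exact subset_univ _
    · rw [uniqueMDiffWithinAt_iff_uniqueDiffWithinAt]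
      exact uniqueDiffOn_Icc zero_lt_one t ht
  have : mfderivWithin 𝓘(ℝ, ℝ) 𝓘(ℝ, E) γ (Icc 0 1) t 1 =
      (mfderivWithin 𝓘(ℝ, E) 𝓘(ℝ, E) (extChartAt 𝓘(ℝ, E) p).symm univ (η t))
        (mfderivWithin 𝓘(ℝ, ℝ) 𝓘(ℝ, E) η (Icc 0 1) t 1) := congr($this 1)
  rw [this]
  refine (hη.2 ht _).trans ?_
  simp only [mfderivWithin_eq_fderivWithin]
  exact le_of_eq rfl

variable {F : Type*} [NormedAddCommGroup F] [NormedSpace ℝ F]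

/-- Near `p`, `f` is its coordinate expression composed with the chart, and the derivatives of both
factors are locally bounded. -/
theorem eventually_enorm_mfderiv_le {f : X → F} (hf : ContMDiff 𝓘(ℝ, E) 𝓘(ℝ, F) ∞ f) (p : X) :
    ∃ C : ℝ≥0, ∀ᶠ y in 𝓝 p, ∀ v : TangentSpace 𝓘(ℝ, E) y,
      ‖mfderiv 𝓘(ℝ, E) 𝓘(ℝ, F) f y v‖ₑ ≤ C * ‖v‖ₑ := by
  have : IsManifold 𝓘(ℝ, E) 1 X := IsManifold.of_le (n := ∞) (by exact_mod_cast le_top)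
  obtain ⟨C, -, hC⟩ := eventually_enorm_mfderiv_extChartAt_lt 𝓘(ℝ, E) p
  have hc : ContinuousAt (fun x => fderiv ℝ (f ∘ (extChartAt 𝓘(ℝ, E) p).symm)
      (extChartAt 𝓘(ℝ, E) p x)) p :=
    (((contDiffOn_comp_symm hf p).continuousOn_fderiv_of_isOpen (isOpen_target p)
      (by simp)).continuousAt (extChartAt_target_mem_nhds p)).comp (continuousAt_extChartAt p)
  have hD := hc.nnnorm.eventually (gt_mem_nhds (lt_add_one _))
  refine ⟨(‖fderiv ℝ (f ∘ (extChartAt 𝓘(ℝ, E) p).symm) (extChartAt 𝓘(ℝ, E) p p)‖₊ + 1) * C, ?_⟩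
  filter_upwards [hC, hD,
    (isOpen_extChartAt_source (I := 𝓘(ℝ, E)) p).mem_nhds (mem_extChartAt_source p)]
    with y h1 h2 h3 v
  have hcomp := mfderiv_comp (I := 𝓘(ℝ, E)) (I' := 𝓘(ℝ, E)) (I'' := 𝓘(ℝ, F)) y
    (g := f ∘ (extChartAt 𝓘(ℝ, E) p).symm) (f := extChartAt 𝓘(ℝ, E) p)
    (differentiableAt_comp_symm hf h3).mdifferentiableAt
    (mdifferentiableAt_extChartAt (by simpa using h3))
  have heq : f =ᶠ[𝓝 y] (f ∘ (extChartAt 𝓘(ℝ, E) p).symm) ∘ extChartAt 𝓘(ℝ, E) p := by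
    filter_upwards [(isOpen_extChartAt_source p).mem_nhds h3] with z hz
    simp only [Function.comp_apply, (extChartAt 𝓘(ℝ, E) p).left_inv hz]
  have h4 : mfderiv 𝓘(ℝ, E) 𝓘(ℝ, F) f y v =
      fderiv ℝ (f ∘ (extChartAt 𝓘(ℝ, E) p).symm) (extChartAt 𝓘(ℝ, E) p y)
        (mfderiv 𝓘(ℝ, E) 𝓘(ℝ, E) (extChartAt 𝓘(ℝ, E) p) y v) := by
    have h5 := congrArg (fun L => L v) (heq.mfderiv_eq (I := 𝓘(ℝ, E)) (I' := 𝓘(ℝ, F)))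
    have h6 := congrArg (fun L => L v) hcomp
    rw [mfderiv_eq_fderiv] at h6
    exact h5.trans h6
  have h5 : ∀ w : E, ‖fderiv ℝ (f ∘ (extChartAt 𝓘(ℝ, E) p).symm) (extChartAt 𝓘(ℝ, E) p y) w‖ₑ ≤
      ((‖fderiv ℝ (f ∘ (extChartAt 𝓘(ℝ, E) p).symm) (extChartAt 𝓘(ℝ, E) p p)‖₊ + 1 : ℝ≥0) : ℝ≥0∞)
        * ‖w‖ₑ := by
    intro w
    refine (ContinuousLinearMap.le_opENorm _ _).trans ?_
    gcongr
    exact ENNReal.coe_le_coe.2 h2.le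
  have h6 : ‖mfderiv 𝓘(ℝ, E) 𝓘(ℝ, E) (extChartAt 𝓘(ℝ, E) p) y v‖ₑ ≤ C * ‖v‖ₑ := by
    refine (ContinuousLinearMap.le_opENorm _ _).trans ?_
    gcongr
    exact h1.le
  rw [h4, ENNReal.coe_mul, mul_assoc]
  refine (h5 _).trans ?_
  gcongr
  exact h6

/-- Compactness of the support makes the local derivative bounds uniform; integrating along paths of
almost minimal length gives the estimate. -/
theorem exists_edist_le_riemannianEDist {f : X → F} (hf : ContMDiff 𝓘(ℝ, E) 𝓘(ℝ, F) ∞ f)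
    (hs : HasCompactSupport f) :
    ∃ C : ℝ≥0, ∀ x y, edist (f x) (f y) ≤ C * riemannianEDist 𝓘(ℝ, E) x y := by
  have : IsManifold 𝓘(ℝ, E) 1 X := IsManifold.of_le (n := ∞) (by exact_mod_cast le_top)
  have hbound : ∃ C : ℝ≥0, ∀ y, ∀ v : TangentSpace 𝓘(ℝ, E) y,
      ‖mfderiv 𝓘(ℝ, E) 𝓘(ℝ, F) f y v‖ₑ ≤ C * ‖v‖ₑ := by
    choose C hC using eventually_enorm_mfderiv_le hf
    obtain ⟨t, -, ht⟩ := IsCompact.elim_nhds_subcover hs _ fun p _ => hC p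
    refine ⟨∑ p ∈ t, C p, fun y v => ?_⟩
    by_cases hy : y ∈ tsupport f
    · obtain ⟨p, hp, hpy⟩ := mem_iUnion₂.1 (ht hy)
      refine (hpy v).trans ?_
      gcongr
      exact Finset.single_le_sum (f := C) (fun _ _ => zero_le) hp
    · have h0 : f =ᶠ[𝓝 y] fun _ => 0 := notMem_tsupport_iff_eventuallyEq.1 hy
      rw [h0.mfderiv_eq, mfderiv_const]
      exact (enorm_zero (E := F)).le.trans zero_le
  obtain ⟨C, hC⟩ := hbound
  have hpath : ∀ x y r, riemannianEDist 𝓘(ℝ, E) x y < r → edist (f x) (f y) ≤ C * r := by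
    intro x y r hr
    obtain ⟨γ, rfl, rfl, hγ, hlen⟩ := exists_lt_of_riemannianEDist_lt hr
    have hfγ : ContDiffOn ℝ 1 (f ∘ γ) (Icc 0 1) :=
      contMDiffOn_iff_contDiffOn.1 ((hf.of_le (by exact_mod_cast le_top)).comp_contMDiffOn hγ)
    rw [edist_comm, edist_eq_enorm_sub]
    refine (enorm_sub_le_lintegral_derivWithin_Icc_of_contDiffOn_Icc hfγ zero_le_one).trans ?_
    refine le_trans ?_ (mul_le_mul_right hlen.le _)
    rw [pathELength_eq_lintegral_mfderivWithin_Icc,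
      ← MeasureTheory.lintegral_const_mul' _ _ ENNReal.coe_ne_top]
    refine MeasureTheory.setLIntegral_mono' measurableSet_Icc fun t ht => ?_
    have h1 : mfderivWithin 𝓘(ℝ, ℝ) 𝓘(ℝ, F) (f ∘ γ) (Icc 0 1) t =
        (mfderiv 𝓘(ℝ, E) 𝓘(ℝ, F) f (γ t)).comp
          (mfderivWithin 𝓘(ℝ, ℝ) 𝓘(ℝ, E) γ (Icc 0 1) t) := by
      refine mfderiv_comp_mfderivWithin t ?_ (hγ.mdifferentiableOn one_ne_zero t ht) ?_
      · exact hf.mdifferentiableAt (by simp)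
      · rw [uniqueMDiffWithinAt_iff_uniqueDiffWithinAt]
        exact uniqueDiffOn_Icc zero_lt_one t ht
    have h2 := congrArg (fun L => L (1 : ℝ)) h1
    rw [mfderivWithin_eq_fderivWithin] at h2
    rw [← fderivWithin_derivWithin]
    exact le_of_eq_of_le (congrArg _ h2) (hC _ _)
  -- The constant must be nonzero: otherwise its product with an infinite distance would be `0`. It
  -- also serves as the denominator of the slack below.
  refine ⟨C + 1, fun x y => ?_⟩
  by_cases htop : riemannianEDist 𝓘(ℝ, E) x y = ⊤
  · rw [htop, ENNReal.mul_top (by simp)]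
    exact le_top
  · refine ENNReal.le_of_forall_pos_le_add fun δ hδ _ => ?_
    have h := hpath x y (riemannianEDist 𝓘(ℝ, E) x y + (δ / (C + 1) : ℝ≥0))
      (ENNReal.lt_add_right htop (by simp [hδ.ne']))
    refine h.trans ?_
    rw [mul_add]
    gcongr
    · exact_mod_cast le_self_add
    · rw [← ENNReal.coe_mul, ENNReal.coe_le_coe, ← mul_div_assoc]
      refine div_le_of_le_mul₀ zero_le zero_le ?_
      rw [mul_comm]
      gcongr
      exact le_self_add

end Bounds

/-! ### Negligible distance and test functions. -/

variable {F : Type*} [NormedAddCommGroup F] [NormedSpace ℝ F]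

theorem RMetric.exists_dist_le (g : RMetric E X) (p : X) :
    ∃ (C : ℝ≥0) (χ : SmoothBumpFunction 𝓘(ℝ, E) p), ∀ x ∈ chartBall χ, ∀ y ∈ chartBall χ,
      g.dist x y ≤ C * edist (extChartAt 𝓘(ℝ, E) p x) (extChartAt 𝓘(ℝ, E) p y) := by
  let : RiemannianBundle (fun x : X => TangentSpace 𝓘(ℝ, E) x) := ⟨g.toRiemannianMetric⟩
  have : IsContinuousRiemannianBundle E (fun x : X => TangentSpace 𝓘(ℝ, E) x) :=
    ⟨⟨g.inner, g.contMDiff.continuous, fun _ _ _ => rfl⟩⟩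
  exact exists_riemannianEDist_le_edist p

theorem RMetric.exists_edist_le (g : RMetric E X) {f : X → F}
    (hf : ContMDiff 𝓘(ℝ, E) 𝓘(ℝ, F) ∞ f) (hs : HasCompactSupport f) :
    ∃ C : ℝ≥0, ∀ x y, edist (f x) (f y) ≤ C * g.dist x y := by
  let : RiemannianBundle (fun x : X => TangentSpace 𝓘(ℝ, E) x) := ⟨g.toRiemannianMetric⟩
  have : IsContinuousRiemannianBundle E (fun x : X => TangentSpace 𝓘(ℝ, E) x) :=
    ⟨⟨g.inner, g.contMDiff.continuous, fun _ _ _ => rfl⟩⟩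
  exact exists_edist_le_riemannianEDist hf hs

theorem RMetric.negl_sub (g : RMetric E X) {f : X → F}
    (hf : ContMDiff 𝓘(ℝ, E) 𝓘(ℝ, F) ∞ f) (hs : HasCompactSupport f) {x y : ℝ → X}
    (h : ∀ m : ℕ, ∃ C : ℝ, ∀ᶠ ε in 𝓝[>] (0 : ℝ),
      g.dist (x ε) (y ε) ≤ ENNReal.ofReal (C * ε ^ m)) :
    Negl (𝓝[>] 0) fun ε => f (x ε) - f (y ε) := by
  intro m
  obtain ⟨C, hC⟩ := g.exists_edist_le hf hs
  obtain ⟨D, hD⟩ := h m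
  refine IsBigO.of_bound (C * |D|) ?_
  filter_upwards [hD, self_mem_nhdsWithin] with ε hε (hpos : 0 < ε)
  have h1 : edist (f (x ε)) (f (y ε)) ≤ ENNReal.ofReal (C * (|D| * ε ^ m)) := by
    refine (hC _ _).trans ?_
    rw [ENNReal.ofReal_mul (NNReal.coe_nonneg C), ENNReal.ofReal_coe_nnreal]
    gcongr
    refine hε.trans (ENNReal.ofReal_le_ofReal ?_)
    gcongr
    exact le_abs_self D
  rw [edist_dist, ENNReal.ofReal_le_ofReal_iff (by positivity), dist_eq_norm] at h1
  rw [Real.norm_of_nonneg (by positivity : (0 : ℝ) ≤ ε ^ m)]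
  linarith

/-- Nets at negligible Riemannian distance are not distinguished by test functions. -/
theorem TestClose.of_dist (g : RMetric E X) (χ : ∀ p : X, SmoothBumpFunction 𝓘(ℝ, E) p)
    (t : Finset X) {x y : ℝ → X}
    (h : ∀ m : ℕ, ∃ C : ℝ, ∀ᶠ ε in 𝓝[>] (0 : ℝ),
      g.dist (x ε) (y ε) ≤ ENNReal.ofReal (C * ε ^ m)) :
    TestClose χ t (𝓝[>] 0) x y := fun p _ =>
  ⟨g.negl_sub (innerBump (χ p)).contMDiff (innerBump (χ p)).hasCompactSupport h,
    g.negl_sub (contMDiff_chartMap (χ p)) (χ p).hasCompactSupport.smul_right h⟩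

/-- Nets that are not distinguished by test functions are at negligible Riemannian distance, if
the chart patches are small enough for the metric. -/
theorem TestClose.dist_le {g : RMetric E X} {χ : ∀ p : X, SmoothBumpFunction 𝓘(ℝ, E) p}
    {C : X → ℝ≥0} (hC : ∀ p, ∀ x ∈ chartBall (χ p), ∀ y ∈ chartBall (χ p),
      g.dist x y ≤ C p * edist (extChartAt 𝓘(ℝ, E) p x) (extChartAt 𝓘(ℝ, E) p y))
    {t : Finset X} {x y : ℝ → X} (h : TestClose χ t (𝓝[>] 0) x y)
    (hx : ∀ᶠ ε in 𝓝[>] 0, ∃ p ∈ t, innerBump (χ p) (x ε) = 1) (m : ℕ) :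
    ∃ C : ℝ, ∀ᶠ ε in 𝓝[>] (0 : ℝ), g.dist (x ε) (y ε) ≤ ENNReal.ofReal (C * ε ^ m) := by
  have h1 : Negl (𝓝[>] 0) fun ε => (g.dist (x ε) (y ε)).toReal := by
    refine Negl.of_finset_cover t hx fun p hp => ?_
    obtain ⟨h1, h2, h3⟩ := h.chart hp
    refine h3.of_le (C p) ?_
    filter_upwards [h1, h2] with ε hx hy
    have := ENNReal.toReal_mono (by finiteness) (hC p _ hx _ hy)
    rwa [ENNReal.toReal_mul, ENNReal.coe_toReal, edist_dist, ENNReal.toReal_ofReal dist_nonneg,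
      dist_eq_norm, ← Real.norm_of_nonneg (ENNReal.toReal_nonneg (a := g.dist _ _))] at this
  -- `toReal` sends `⊤` to `0`, so finiteness has to be shown separately before the real estimate
  -- can be transferred back.
  have h2 : ∀ᶠ ε in 𝓝[>] 0, g.dist (x ε) (y ε) ≠ ⊤ := by
    have : ∀ p ∈ t, ∀ᶠ ε in 𝓝[>] 0, innerBump (χ p) (x ε) = 1 → g.dist (x ε) (y ε) ≠ ⊤ := by
      intro p hp
      obtain ⟨h1, h2, -⟩ := h.chart hp
      filter_upwards [eventually_inf_principal.1 h1, eventually_inf_principal.1 h2]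
        with ε h1 h2 h3
      exact ne_top_of_le_ne_top (by finiteness) (hC p _ (h1 h3) _ (h2 h3))
    filter_upwards [hx, (eventually_all_finset t).2 this] with ε ⟨p, hp, hε⟩ h
    exact h p hp hε
  obtain ⟨D, hD⟩ := (h1 m).bound
  refine ⟨D, ?_⟩
  filter_upwards [h2, hD, self_mem_nhdsWithin] with ε hε hε' (hpos : 0 < ε)
  rw [Real.norm_of_nonneg ENNReal.toReal_nonneg,
    Real.norm_of_nonneg (by positivity : (0 : ℝ) ≤ ε ^ m)] at hε'
  exact (ENNReal.le_ofReal_iff_toReal_le hε (ENNReal.toReal_nonneg.trans hε')).2 hε'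

end Riemannian

/-! ### Quotient maps -/

section Quotients

variable {𝕜 : Type*} [RCLike 𝕜] {E : Type*} [NormedAddCommGroup E] [NormedSpace ℝ E]
  {X : Type*} [TopologicalSpace X] [ChartedSpace E X]

/-- The class of a moderate net of scalars. -/
def mkNum : scalarModerate 𝕜 →+* GenNumber 𝕜 := Ideal.Quotient.mk (scalarNegligible 𝕜)

/-- The class of a moderate net of functions. -/
def mkFun : moderate 𝕜 E X →+* GenFun 𝕜 E X := Ideal.Quotient.mk (negligible 𝕜 E X)

theorem mkNum_surjective : Function.Surjective (mkNum (𝕜 := 𝕜)) := Ideal.Quotient.mk_surjective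

theorem mkFun_surjective : Function.Surjective (mkFun (𝕜 := 𝕜) (E := E) (X := X)) :=
  Ideal.Quotient.mk_surjective

theorem mkNum_eq_zero {a : scalarModerate 𝕜} : mkNum a = 0 ↔ Negl (𝓝[>] 0) a.1 :=
  Ideal.Quotient.eq_zero_iff_mem

theorem mkNum_eq_mkNum {a b : scalarModerate 𝕜} :
    mkNum a = mkNum b ↔ Negl (𝓝[>] 0) fun ε => a.1 ε - b.1 ε :=
  Ideal.Quotient.eq

theorem mkFun_eq_zero {u : moderate 𝕜 E X} : mkFun u = 0 ↔
    ∀ K : Set X, IsCompact K → ∀ m : ℕ, UniformBigO 𝕜 X K (fun ε => u.1 ε) fun ε => ε ^ m :=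
  Ideal.Quotient.eq_zero_iff_mem

theorem algebraMap_mkNum (a : scalarModerate 𝕜) :
    algebraMap (GenNumber 𝕜) (GenFun 𝕜 E X) (mkNum a) = mkFun (constNet 𝕜 E X a) := rfl

theorem evalNet_mkFun_eq (x : CompactNet E X) (u : moderate 𝕜 E X) (a : scalarModerate 𝕜) :
    evalNet 𝕜 x (mkFun u) = mkNum a ↔
      Negl (𝓝[>] 0) fun ε => u.1 ε (x.toFun ε) - a.1 ε :=
  Ideal.Quotient.eq

theorem evalNet_mkFun_eq_evalNet (x y : CompactNet E X) (u : moderate 𝕜 E X) :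
    evalNet 𝕜 x (mkFun u) = evalNet 𝕜 y (mkFun u) ↔
      Negl (𝓝[>] 0) fun ε => u.1 ε (x.toFun ε) - u.1 ε (y.toFun ε) :=
  Ideal.Quotient.eq

/-- The ring of generalized numbers has no idempotents except `0` and `1`. -/
theorem GenNumber.eq_zero_or_one_of_mul_self {e : GenNumber 𝕜} (he : e * e = e) :
    e = 0 ∨ e = 1 := by
  obtain ⟨r, rfl⟩ := mkNum_surjective e
  rw [← map_mul, mkNum_eq_mkNum] at he
  change Negl (𝓝[>] 0) fun ε => r.1 ε * r.1 ε - r.1 ε at he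
  have hnorm : ∀ ε, ‖r.1 ε * r.1 ε - r.1 ε‖ = ‖r.1 ε‖ * ‖r.1 ε - 1‖ := fun ε => by
    rw [← norm_mul, mul_sub, mul_one]
  have htri : ∀ ε, 1 ≤ ‖r.1 ε‖ + ‖r.1 ε - 1‖ := fun ε => by
    calc (1 : ℝ) = ‖r.1 ε - (r.1 ε - 1)‖ := by simp
      _ ≤ _ := norm_sub_le _ _
  -- If `‖r‖ = 1/2`, then `‖r - 1‖ ≥ 1/2` and the product is at least `1/4`; so near `0` the norm
  -- avoids `1/2` and, by continuity in `ε`, stays on one side of it.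
  obtain ⟨δ, hδ, hδ'⟩ := mem_nhdsGT_iff_exists_Ioo_subset.1
    ((he.eventually_lt le_rfl (by norm_num : (0 : ℝ) < 1 / 4)).and
      (Ioo_mem_nhdsGT (zero_lt_one : (0 : ℝ) < 1)))
  have hcont : ContinuousOn (fun ε => ‖r.1 ε‖) (Ioo 0 δ) :=
    (r.2.1.continuousOn.mono fun ε hε => ⟨(hδ' hε).2.1, (hδ' hε).2.2.le⟩).norm
  have hne : ∀ ε ∈ Ioo 0 δ, ‖r.1 ε‖ ≠ 1 / 2 := by
    intro ε hε h
    have h1 := (hδ' hε).1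
    have h2 := htri ε
    rw [hnorm, h] at h1
    linarith
  have hδpos : (0 : ℝ) < δ := hδ
  have hcases : (∀ ε ∈ Ioo 0 δ, ‖r.1 ε‖ < 1 / 2) ∨ ∀ ε ∈ Ioo 0 δ, 1 / 2 < ‖r.1 ε‖ := by
    by_contra! h
    obtain ⟨⟨a, ha, ha'⟩, b, hb, hb'⟩ := h
    obtain ⟨c, hc, hc'⟩ := (isPreconnected_Ioo (a := 0) (b := δ)).intermediate_value hb ha hcont
      ⟨hb', ha'⟩
    exact hne c hc hc'
  rcases hcases with h | h
  · left
    rw [mkNum_eq_zero]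
    -- Here `‖r - 1‖ ≥ 1/2`, so `‖r‖` is at most twice the negligible product.
    refine he.of_le 2 ?_
    filter_upwards [Ioo_mem_nhdsGT hδpos] with ε hε
    rw [hnorm]
    nlinarith [h ε hε, htri ε, norm_nonneg (r.1 ε)]
  · right
    rw [← map_one mkNum, mkNum_eq_mkNum]
    refine he.of_le 2 ?_
    filter_upwards [Ioo_mem_nhdsGT hδpos] with ε hε
    rw [hnorm]
    change ‖r.1 ε - 1‖ ≤ _
    nlinarith [h ε hε, htri ε, norm_nonneg (r.1 ε - 1)]

variable {ν : GenFun 𝕜 E X →ₗ[GenNumber 𝕜] GenNumber 𝕜}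

theorem map_one_of_mul (hmul : ∀ u v, ν (u * v) = ν u * ν v) (hne : ν ≠ 0) : ν 1 = 1 := by
  have h : ν 1 * ν 1 = ν 1 := by rw [← hmul, one_mul]
  rcases GenNumber.eq_zero_or_one_of_mul_self h with h0 | h1
  · refine absurd (LinearMap.ext fun u => ?_) hne
    rw [← one_mul u, hmul, h0, zero_mul]
    rfl
  · exact h1

theorem map_constNet (hmul : ∀ u v, ν (u * v) = ν u * ν v) (hne : ν ≠ 0) (a : scalarModerate 𝕜) :
    ν (mkFun (constNet 𝕜 E X a)) = mkNum a := by
  rw [← algebraMap_mkNum, Algebra.algebraMap_eq_smul_one, map_smul, map_one_of_mul hmul hne,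
    smul_eq_mul, mul_one]

/-! ### Conjugation and inversion of nets -/

/-- Complex conjugation of smooth functions. -/
def conjSmooth : Smooth 𝕜 E X →ₐ[ℝ] Smooth 𝕜 E X where
  toFun u := ⟨fun x => starRingEnd 𝕜 (u x),
    (RCLike.conjCLE (K := 𝕜)).contDiff.contMDiff.comp u.contMDiff⟩
  map_one' := by ext x; exact map_one (starRingEnd 𝕜)
  map_mul' u v := by ext x; exact map_mul (starRingEnd 𝕜) _ _
  map_zero' := by ext x; exact map_zero (starRingEnd 𝕜)
  map_add' u v := by ext x; exact map_add (starRingEnd 𝕜) _ _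
  commutes' r := by ext x; exact RCLike.conj_ofReal r

theorem conjSmooth_apply (u : Smooth 𝕜 E X) (x : X) :
    conjSmooth u x = starRingEnd 𝕜 (u x) := rfl

theorem conjSmooth_conjSmooth (u : Smooth 𝕜 E X) : conjSmooth (conjSmooth u) = u := by
  ext x
  simp [conjSmooth_apply]

/-- Conjugation by `conjSmooth` sends multiplication by `f` to multiplication by its conjugate, and
real derivations to real derivations. This makes conjugate nets moderate. -/
theorem exists_conj_diffOps {P : Module.End ℝ (Smooth 𝕜 E X)} (hP : P ∈ diffOps 𝕜 E X) :
    ∃ Q ∈ diffOps 𝕜 E X, ∀ u, P (conjSmooth u) = conjSmooth (Q u) := by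
  induction hP using Algebra.adjoin_induction with
  | mem P h =>
    rcases h with ⟨f, hf⟩ | ⟨D, hD⟩
    · refine ⟨LinearMap.mulLeft ℝ (conjSmooth f), Algebra.subset_adjoin (Or.inl ⟨_, fun _ => rfl⟩),
        fun u => ?_⟩
      rw [LinearMap.mulLeft_apply, map_mul, conjSmooth_conjSmooth, hf]
    · let D' : Derivation ℝ (Smooth 𝕜 E X) (Smooth 𝕜 E X) := Derivation.mk'
        (conjSmooth.toLinearMap ∘ₗ D.toLinearMap ∘ₗ conjSmooth.toLinearMap) fun u v => by
          simp [conjSmooth_conjSmooth]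
      refine ⟨D', Algebra.subset_adjoin (Or.inr ⟨D', fun _ => rfl⟩), fun u => ?_⟩
      change P (conjSmooth u) = conjSmooth (conjSmooth (D (conjSmooth u)))
      rw [conjSmooth_conjSmooth, hD]
  | algebraMap r =>
    refine ⟨algebraMap ℝ _ r, Subalgebra.algebraMap_mem _ r, fun u => ?_⟩
    simp [Algebra.algebraMap_eq_smul_one]
  | add P Q _ _ hP hQ =>
    obtain ⟨P', hP', h⟩ := hP
    obtain ⟨Q', hQ', h'⟩ := hQ
    exact ⟨P' + Q', add_mem hP' hQ', fun u => by simp [h, h']⟩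
  | mul P Q _ _ hP hQ =>
    obtain ⟨P', hP', h⟩ := hP
    obtain ⟨Q', hQ', h'⟩ := hQ
    exact ⟨P' * Q', mul_mem hP' hQ', fun u => by simp [h, h']⟩

/-- The complex conjugate of a moderate net. -/
def conjNet (u : moderate 𝕜 E X) : moderate 𝕜 E X :=
  ⟨fun ε => conjSmooth (u.1 ε),
    (RCLike.conjCLE (K := 𝕜)).contDiff.contMDiff.comp_contMDiffOn u.2.1, fun K hK P hP => by
      obtain ⟨Q, hQ, h⟩ := exists_conj_diffOps hP
      obtain ⟨N, hN⟩ := u.2.2 K hK Q hQ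
      obtain ⟨C, hC⟩ := uniformBigO_iff.1 hN
      refine ⟨N, uniformBigO_iff.2 ⟨C, hC.mono fun ε hε x hx => ?_⟩⟩
      rw [h, conjSmooth_apply, RCLike.norm_conj]
      exact hε x hx⟩

theorem contMDiff_inv_smooth {v : Smooth 𝕜 E X} (h : ∀ x, v x ≠ 0) :
    ContMDiff 𝓘(ℝ, E) 𝓘(ℝ, 𝕜) ∞ fun x => (v x)⁻¹ := fun x =>
  ((contDiffAt_inv 𝕜 (h x)).restrict_scalars ℝ).contMDiffAt.comp x v.contMDiff.contMDiffAt

/-- The reciprocal of a nowhere vanishing function. -/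
def recipSmooth (v : Smooth 𝕜 E X) (h : ∀ x, v x ≠ 0) : Smooth 𝕜 E X :=
  ⟨fun x => (v x)⁻¹, contMDiff_inv_smooth h⟩

open Classical in
/-- The reciprocal of a nowhere vanishing function, and `0` for other functions. -/
def invSmooth (v : Smooth 𝕜 E X) : Smooth 𝕜 E X :=
  if h : ∀ x, v x ≠ 0 then recipSmooth v h else 0

theorem invSmooth_apply {v : Smooth 𝕜 E X} (h : ∀ x, v x ≠ 0) (x : X) :
    invSmooth v x = (v x)⁻¹ := by
  rw [invSmooth, dif_pos h]
  rfl

/-- Differentiating `v⁻¹ * v = 1` gives the formula; the default value `0` keeps it valid for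
functions with zeros. -/
theorem derivation_invSmooth (D : Derivation ℝ (Smooth 𝕜 E X) (Smooth 𝕜 E X))
    (v : Smooth 𝕜 E X) : D (invSmooth v) = -(invSmooth v * invSmooth v) * D v := by
  by_cases h : ∀ x, v x ≠ 0
  · have h1 : invSmooth v * v = 1 := by
      ext x
      change invSmooth v x * v x = 1
      rw [invSmooth_apply h, inv_mul_cancel₀ (h x)]
    rw [D.leibniz_of_mul_eq_one h1, smul_eq_mul, sq]
  · rw [invSmooth, dif_neg h]
    simp

variable (𝕜 E X) in
/-- Nets of functions that are `O(ε⁻ᴺ)` on compact sets, without conditions on derivatives. -/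
def orderModerate : Subring (ℝ → Smooth 𝕜 E X) where
  carrier := {u | ∀ K : Set X, IsCompact K →
    ∃ N : ℕ, UniformBigO 𝕜 X K (fun ε => u ε) fun ε => ε ^ (-(N : ℤ))}
  mul_mem' := by
    intro u v hu hv K hK
    obtain ⟨N, hN⟩ := hu K hK
    obtain ⟨M, hM⟩ := hv K hK
    exact ⟨N + M, hN.mul hM (zpow_neg_mul_zpow_neg N M)⟩
  one_mem' := fun K hK => ⟨0, uniformBigO_iff.2 ⟨1, Eventually.of_forall fun ε x hx => by simp⟩⟩
  add_mem' := by
    intro u v hu hv K hK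
    obtain ⟨N, hN⟩ := hu K hK
    obtain ⟨M, hM⟩ := hv K hK
    exact ⟨max N M, IsBigO.add (hN.trans (isBigO_zpow_neg (le_max_left _ _)))
      (hM.trans (isBigO_zpow_neg (le_max_right _ _)))⟩
  zero_mem' := fun K hK => ⟨0, isBigO_zero _ _⟩
  neg_mem' := by
    intro u hu K hK
    obtain ⟨N, hN⟩ := hu K hK
    exact ⟨N, IsBigO.neg_left hN⟩

open Classical in
/-- The reciprocals of a net of functions, for parameters in `S`. -/
def invNet (S : Set ℝ) (v : ℝ → Smooth 𝕜 E X) (ε : ℝ) : Smooth 𝕜 E X :=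
  if ε ∈ S then invSmooth (v ε) else 0

theorem derivation_invNet (D : Derivation ℝ (Smooth 𝕜 E X) (Smooth 𝕜 E X)) (S : Set ℝ)
    (v : ℝ → Smooth 𝕜 E X) (ε : ℝ) :
    D (invNet S v ε) = -(invNet S v ε * invNet S v ε) * D (v ε) := by
  unfold invNet
  split_ifs
  · exact derivation_invSmooth D _
  · simp

/-- Reciprocals of a moderate net that is bounded below by a power of `ε` are moderate. -/
theorem diffOps_invNet_orderModerate {S : Set ℝ} (v : moderate 𝕜 E X)
    (hv : invNet S v.1 ∈ orderModerate 𝕜 E X) {P : Module.End ℝ (Smooth 𝕜 E X)}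
    (hP : P ∈ diffOps 𝕜 E X) : (fun ε => P (invNet S v.1 ε)) ∈ orderModerate 𝕜 E X := by
  -- The ring generated by the reciprocals, the nets `Q v` and the fixed functions is stable under
  -- derivations, because `D (1/v) = -(1/v)² * D v`. Bounds on the generators thus control all
  -- differential operators applied to the reciprocals.
  let gens : Set (ℝ → Smooth 𝕜 E X) := insert (invNet S v.1)
    ({w | ∃ Q ∈ diffOps 𝕜 E X, w = fun ε => Q (v.1 ε)} ∪ range fun f => fun _ => f)
  have hconst : ∀ f : Smooth 𝕜 E X, (fun _ => f) ∈ Subring.closure gens := fun f =>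
    Subring.subset_closure (Or.inr (Or.inr ⟨f, rfl⟩))
  have hle : Subring.closure gens ≤ orderModerate 𝕜 E X := by
    rw [Subring.closure_le]
    rintro w (rfl | ⟨Q, hQ, rfl⟩ | ⟨f, rfl⟩) K hK
    · exact hv K hK
    · exact v.2.2 K hK Q hQ
    · obtain ⟨C, hC⟩ := hK.exists_bound_of_continuousOn f.contMDiff.continuous.continuousOn
      exact ⟨0, uniformBigO_iff.2 ⟨C, Eventually.of_forall fun ε x hx => by simpa using hC x hx⟩⟩
  have hD : ∀ D : Derivation ℝ (Smooth 𝕜 E X) (Smooth 𝕜 E X), ∀ w ∈ Subring.closure gens,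
      (fun ε => D (w ε)) ∈ Subring.closure gens := by
    intro D w hw
    have hDm : (D : Module.End ℝ (Smooth 𝕜 E X)) ∈ diffOps 𝕜 E X :=
      Algebra.subset_adjoin (Or.inr ⟨D, fun _ => rfl⟩)
    induction hw using Subring.closure_induction with
    | mem w hw =>
      rcases hw with rfl | ⟨Q, hQ, rfl⟩ | ⟨f, rfl⟩
      · simp only [derivation_invNet]
        exact mul_mem (neg_mem (mul_mem (Subring.subset_closure (Or.inl rfl))
          (Subring.subset_closure (Or.inl rfl))))
          (Subring.subset_closure (Or.inr (Or.inl ⟨_, hDm, rfl⟩)))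
      · exact Subring.subset_closure (Or.inr (Or.inl ⟨_, mul_mem hDm hQ, rfl⟩))
      · exact hconst _
    | zero => simpa using hconst 0
    | one => simpa using hconst 0
    | add a b _ _ ha hb =>
      simp only [Pi.add_apply, map_add]
      exact add_mem ha hb
    | neg a _ ha =>
      simp only [Pi.neg_apply, map_neg]
      exact neg_mem ha
    | mul a b ha' hb' ha hb =>
      simp only [Pi.mul_apply, Derivation.leibniz, smul_eq_mul]
      exact add_mem (mul_mem ha' hb) (mul_mem hb' ha)
  have hP' : ∀ w ∈ Subring.closure gens, (fun ε => P (w ε)) ∈ Subring.closure gens := by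
    induction hP using Algebra.adjoin_induction with
    | mem P h =>
      intro w hw
      rcases h with ⟨f, hf⟩ | ⟨D, hD'⟩
      · simp only [hf]
        exact mul_mem (hconst f) hw
      · simp only [hD']
        exact hD D w hw
    | algebraMap r =>
      intro w hw
      have := mul_mem (hconst (r • 1)) hw
      simpa [Algebra.algebraMap_eq_smul_one, Pi.mul_def] using this
    | add P Q _ _ hP hQ =>
      intro w hw
      exact add_mem (hP w hw) (hQ w hw)
    | mul P Q _ _ hP hQ =>
      intro w hw
      simpa using hP _ (hQ w hw)
  exact hle (hP' _ (Subring.subset_closure (Or.inl rfl)))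

end Quotients

/-! ### Elements of the kernel are small somewhere -/

theorem isClosed_range_of_tendsto_atTop {e : ℕ → ℝ} (he : Tendsto e atTop atTop) :
    IsClosed (range e) := by
  have : IsProperMap e := by
    rw [isProperMap_iff_tendsto_cocompact, cocompact_eq_cofinite, Nat.cofinite_eq_atTop]
    exact ⟨continuous_of_discreteTopology, he.mono_right atTop_le_cocompact⟩
  exact this.isClosedMap.isClosed_range

/-- A smooth function on `(0, ∞)` supported in an open set and equal to `1` along a sequence in
this set that tends to `0`. -/
theorem exists_contDiffOn_eq_one_of_tendsto {S : Set ℝ} (hS : IsOpen S) (hS0 : S ⊆ Ioi 0)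
    {e : ℕ → ℝ} (he : ∀ k, e k ∈ S) (he0 : Tendsto e atTop (𝓝 0)) :
    ∃ ρ : ℝ → ℝ, ContDiffOn ℝ ∞ ρ (Ioi 0) ∧ (∀ ε, ρ ε ∈ Icc 0 1) ∧ (∀ k, ρ (e k) = 1) ∧
      ∀ ε ∈ Ioi (0 : ℝ), ε ∉ S → ∀ᶠ ε' in 𝓝 ε, ρ ε' = 0 := by
  -- Inversion moves the accumulation point `0` of the sequence to infinity, so its image is closed
  -- in `ℝ` and a smooth Urysohn function exists; it is pulled back by `ε ↦ ε⁻¹`.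
  have hT : IsOpen (Ioi (0 : ℝ) ∩ Inv.inv ⁻¹' S) :=
    (continuousOn_inv₀.mono fun x (hx : (0 : ℝ) < x) => hx.ne').isOpen_inter_preimage isOpen_Ioi hS
  have hR : IsClosed (range fun k => (e k)⁻¹) := by
    refine isClosed_range_of_tendsto_atTop (tendsto_inv_nhdsGT_zero.comp
      (tendsto_nhdsWithin_iff.2 ⟨he0, Eventually.of_forall fun k => hS0 (he k)⟩))
  obtain ⟨σ, hσ0, hσ1, hσ⟩ := exists_contMDiffMap_zero_one_nhds_of_isClosed (n := ⊤) 𝓘(ℝ, ℝ)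
    hT.isClosed_compl hR (by
      rw [disjoint_compl_left_iff_subset]
      rintro _ ⟨k, rfl⟩
      exact ⟨mem_Ioi.2 (inv_pos.2 (hS0 (he k))), by simpa using he k⟩)
  refine ⟨fun ε => σ ε⁻¹, ?_, fun ε => hσ _, fun k => ?_, fun ε hε hεS => ?_⟩
  · exact (contMDiff_iff_contDiff.1 σ.contMDiff).comp_contDiffOn
      (contDiffOn_id.inv fun x hx => (ne_of_gt hx : x ≠ 0))
  · exact hσ1.self_of_nhdsSet _ (mem_range_self k)
  · have h1 : ε⁻¹ ∈ (Ioi (0 : ℝ) ∩ Inv.inv ⁻¹' S)ᶜ := fun h => hεS (by simpa using h.2)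
    exact (continuousAt_inv₀ (ne_of_gt hε)).eventually
      (hσ0.filter_mono (nhds_le_nhdsSet h1))

section

variable {𝕜 : Type*} [RCLike 𝕜] {E : Type*} [NormedAddCommGroup E] [NormedSpace ℝ E]
  {X : Type*} [TopologicalSpace X] [ChartedSpace E X]
  {ν : GenFun 𝕜 E X →ₗ[GenNumber 𝕜] GenNumber 𝕜}

theorem invNet_apply_of_mem {S : Set ℝ} {v : ℝ → Smooth 𝕜 E X} {ε : ℝ} (hε : ε ∈ S)
    (h : ∀ x, v ε x ≠ 0) (x : X) : invNet S v ε x = (v ε x)⁻¹ := by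
  rw [invNet, if_pos hε, invSmooth_apply h]

/-- A moderate net of real numbers bounded by `1`, as a moderate net of scalars. -/
def ofRealNet (ρ : ℝ → ℝ) (hρ : ContDiffOn ℝ ∞ ρ (Ioc 0 1))
    (h1 : ∀ ε ∈ Ioc (0 : ℝ) 1, ρ ε ∈ Icc 0 1) :
    scalarModerate 𝕜 :=
  ⟨fun ε => (ρ ε : 𝕜), (RCLike.ofRealCLM (K := 𝕜)).contDiff.comp_contDiffOn hρ, 0, by
    refine IsBigO.of_bound 1 ?_
    filter_upwards [Ioc_mem_nhdsGT (zero_lt_one : (0 : ℝ) < 1)] with ε hε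
    obtain ⟨h0, h1⟩ := h1 ε hε
    simpa [abs_of_nonneg h0] using h1⟩

/-- The lower bound makes `w = ρ / v` moderate, where `ρ` is a cutoff supported in `S`. Then `v * w`
is the scalar net `ρ`, so `ν v = 0` forces `ρ` to be negligible although it equals `1` along `e`. -/
theorem false_of_forall_le_norm (hmul : ∀ u v, ν (u * v) = ν u * ν v) (hne : ν ≠ 0)
    (v : moderate 𝕜 E X) (hv : ν (mkFun v) = 0) (hv0 : ∀ ε ∈ Ioc (0 : ℝ) 1, ∀ x, v.1 ε x ≠ 0)
    {S : Set ℝ} (hS : IsOpen S) (hS0 : S ⊆ Ioo 0 1)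
    {e : ℕ → ℝ} (he : ∀ k, e k ∈ S) (he0 : Tendsto e atTop (𝓝 0)) (N : ℕ)
    (hN : ∀ K : Set X, IsCompact K → ∀ᶠ ε in 𝓝[>] 0, ε ∈ S → ∀ x ∈ K, ε ^ N ≤ ‖v.1 ε x‖) :
    False := by
  obtain ⟨ρ, hρ, hρ1, hρe, hρS⟩ := exists_contDiffOn_eq_one_of_tendsto hS
    (hS0.trans Ioo_subset_Ioi_self) he he0
  have hvS : ∀ ε ∈ S, ∀ x, v.1 ε x ≠ 0 := fun ε hε => hv0 ε ⟨(hS0 hε).1, (hS0 hε).2.le⟩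
  have hinv : invNet S v.1 ∈ orderModerate 𝕜 E X := by
    intro K hK
    refine ⟨N, uniformBigO_iff.2 ⟨1, ?_⟩⟩
    filter_upwards [hN K hK, self_mem_nhdsWithin] with ε hε (hpos : 0 < ε) x hx
    rw [one_mul, zpow_neg, zpow_natCast, norm_inv, norm_pow, Real.norm_of_nonneg hpos.le]
    by_cases h : ε ∈ S
    · rw [invNet_apply_of_mem h (hvS ε h), norm_inv]
      exact inv_anti₀ (by positivity) (hε h x hx)
    · rw [invNet, if_neg h]
      change ‖(0 : 𝕜)‖ ≤ _
      rw [norm_zero]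
      positivity
  let w : moderate 𝕜 E X := ⟨fun ε => ρ ε • invNet S v.1 ε, by
    rintro ⟨ε, x⟩ ⟨hε, -⟩
    by_cases h : ε ∈ S
    · have h1 : ContMDiffWithinAt (𝓘(ℝ, ℝ).prod 𝓘(ℝ, E)) 𝓘(ℝ, 𝕜) ∞
          (fun p : ℝ × X => ρ p.1 • (v.1 p.1 p.2)⁻¹) (Ioc 0 1 ×ˢ univ) (ε, x) := by
        have hA : ContMDiffWithinAt (𝓘(ℝ, ℝ).prod 𝓘(ℝ, E)) 𝓘(ℝ, ℝ) ∞
            (fun p : ℝ × X => ρ p.1) (Ioc 0 1 ×ˢ univ) (ε, x) :=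
          ((hρ.contDiffAt (Ioi_mem_nhds hε.1)).contMDiffAt.comp (ε, x)
            contMDiffAt_fst).contMDiffWithinAt
        have hB : ContMDiffWithinAt (𝓘(ℝ, ℝ).prod 𝓘(ℝ, E)) 𝓘(ℝ, 𝕜) ∞
            (fun p : ℝ × X => (v.1 p.1 p.2)⁻¹) (Ioc 0 1 ×ˢ univ) (ε, x) :=
          ((contDiffAt_inv 𝕜 (hvS ε h x)).restrict_scalars ℝ).contMDiffAt
            |>.comp_contMDiffWithinAt (ε, x) (v.2.1 (ε, x) ⟨hε, mem_univ _⟩)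
        exact hA.smul hB
      refine h1.congr_of_eventuallyEq ?_ ?_
      · refine nhdsWithin_le_nhds ?_
        filter_upwards [continuous_fst.continuousAt.preimage_mem_nhds (hS.mem_nhds h)] with p hp
        change ρ p.1 • invNet S v.1 p.1 p.2 = _
        rw [invNet_apply_of_mem (show p.1 ∈ S from hp) (hvS _ hp)]
      · change ρ ε • invNet S v.1 ε x = _
        rw [invNet_apply_of_mem h (hvS _ h)]
    -- At parameters outside `S`, including the boundary of `S`, `ρ` vanishes in a whole
    -- neighbourhood, so the product is locally zero.
    · have h0 := hρS ε hε.1 h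
      refine (contMDiffWithinAt_const (c := (0 : 𝕜))).congr_of_eventuallyEq ?_ ?_
      · refine nhdsWithin_le_nhds ?_
        filter_upwards [(continuous_fst.continuousAt (x := (ε, x))).eventually h0] with p hp
        change ρ p.1 • invNet S v.1 p.1 p.2 = _
        rw [hp, zero_smul]
      · change ρ ε • invNet S v.1 ε x = _
        rw [h0.self_of_nhds, zero_smul], by
    intro K hK P hP
    obtain ⟨M, hM⟩ := diffOps_invNet_orderModerate v hinv hP K hK
    obtain ⟨C, hC⟩ := uniformBigO_iff.1 hM
    refine ⟨M, uniformBigO_iff.2 ⟨C, hC.mono fun ε hε x hx => ?_⟩⟩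
    rw [map_smul]
    change ‖ρ ε • P (invNet S v.1 ε) x‖ ≤ _
    rw [norm_smul, Real.norm_of_nonneg (hρ1 ε).1]
    exact (mul_le_of_le_one_left (norm_nonneg _) (hρ1 ε).2).trans (hε x hx)⟩
  let a : scalarModerate 𝕜 := ofRealNet ρ (hρ.mono fun _ h => h.1) fun ε _ => hρ1 ε
  have hvw : mkFun (v * w) = mkFun (constNet 𝕜 E X a) := by
    rw [← sub_eq_zero, ← map_sub, mkFun_eq_zero]
    intro K _ m
    refine uniformBigO_iff.2 ⟨0, ?_⟩
    filter_upwards [self_mem_nhdsWithin] with ε (hε : 0 < ε) x _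
    change ‖v.1 ε x * (ρ ε • invNet S v.1 ε x) - (ρ ε : 𝕜)‖ ≤ _
    by_cases h : ε ∈ S
    · rw [invNet_apply_of_mem h (hvS _ h), RCLike.real_smul_eq_coe_mul, mul_left_comm,
        mul_inv_cancel₀ (hvS ε h x), mul_one, sub_self, norm_zero, zero_mul]
    · rw [(hρS ε hε h).self_of_nhds]
      simp
  have ha : mkNum a = 0 := by
    rw [← map_constNet hmul hne, ← hvw, map_mul, hmul, hv, zero_mul]
  have hlt := (mkNum_eq_zero.1 ha).eventually_lt le_rfl (zero_lt_one : (0 : ℝ) < 1)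
  obtain ⟨k, hk⟩ := ((tendsto_nhdsWithin_iff.2
    ⟨he0, Eventually.of_forall fun k => (hS0 (he k)).1⟩).eventually hlt).exists
  change ‖((ρ (e k) : ℝ) : 𝕜)‖ < 1 at hk
  rw [hρe k] at hk
  simp at hk

theorem continuousOn_moderate (v : moderate 𝕜 E X) :
    ContinuousOn (fun p : ℝ × X => v.1 p.1 p.2) (Ioc 0 1 ×ˢ univ) := v.2.1.continuousOn

theorem isOpen_forall_lt_norm (v : moderate 𝕜 E X) {K : Set X} (hK : IsCompact K) (N : ℕ) :
    IsOpen {ε ∈ Ioo (0 : ℝ) 1 | ∀ x ∈ K, ε ^ N < ‖v.1 ε x‖} := by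
  refine isOpen_iff_mem_nhds.2 fun ε ⟨hε, h⟩ => ?_
  refine inter_mem (isOpen_Ioo.mem_nhds hε) ?_
  refine hK.eventually_forall_of_forall_eventually (P := fun ε x => ε ^ N < ‖v.1 ε x‖)
    fun x hx => ?_
  have h1 : ContinuousAt (fun p : ℝ × X => v.1 p.1 p.2) (ε, x) :=
    (continuousOn_moderate v).continuousAt (prod_mem_nhds (Ioc_mem_nhds hε.1 hε.2) univ_mem)
  have h2 : ContinuousAt (fun p : ℝ × X => p.1 ^ N) (ε, x) := by fun_prop
  exact h2.eventually_lt h1.norm (h x hx)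

/-- Otherwise each member of a compact exhaustion has arbitrarily small parameters at which `v`
exceeds `εᴺ` on it. These assemble into an open set accumulating at `0` on which `v` can be
inverted. -/
theorem exists_compact_forall_exists_norm_le [WeaklyLocallyCompactSpace X] [SigmaCompactSpace X]
    (hmul : ∀ u v, ν (u * v) = ν u * ν v) (hne : ν ≠ 0)
    (v : moderate 𝕜 E X) (hv : ν (mkFun v) = 0) (hv0 : ∀ ε ∈ Ioc (0 : ℝ) 1, ∀ x, v.1 ε x ≠ 0)
    (N : ℕ) : ∃ L : Set X, IsCompact L ∧ ∀ᶠ ε in 𝓝[>] 0, ∃ x ∈ L, ‖v.1 ε x‖ ≤ ε ^ N := by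
  by_contra! h
  let L := CompactExhaustion.choice X
  have h1 : ∀ k : ℕ, ∃ ε : ℝ, (ε ∈ Ioo (0 : ℝ) 1 ∧ ∀ x ∈ L k, ε ^ N < ‖v.1 ε x‖) ∧
      ε < 1 / ((k : ℝ) + 1) := by
    intro k
    obtain ⟨ε, h1, h2, h3⟩ := ((h (L k) (L.isCompact k)).and_eventually
      (inter_mem (Ioo_mem_nhdsGT (zero_lt_one : (0 : ℝ) < 1))
        (Ioo_mem_nhdsGT (Nat.one_div_pos_of_nat (n := k) (α := ℝ))))).exists
    exact ⟨ε, ⟨h2, h1⟩, h3.2⟩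
  choose e he he' using h1
  -- Truncation at `e k / 2` keeps the `k`th piece away from `0`. Parameters of `S` close to `0`
  -- thus come only from pieces with large `k`, whose lower bound holds on a large compact set.
  let S : Set ℝ := ⋃ k, Ioi (e k / 2) ∩ {ε ∈ Ioo (0 : ℝ) 1 | ∀ x ∈ L k, ε ^ N < ‖v.1 ε x‖}
  refine false_of_forall_le_norm hmul hne v hv hv0 (S := S) (e := e) (N := N) ?_ ?_ ?_ ?_ ?_
  · exact isOpen_iUnion fun k => isOpen_Ioi.inter (isOpen_forall_lt_norm v (L.isCompact k) N)
  · exact iUnion_subset fun k ε hε => hε.2.1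
  · exact fun k => mem_iUnion.2 ⟨k, half_lt_self (he k).1.1, he k⟩
  · exact squeeze_zero (fun k => (he k).1.1.le) (fun k => (he' k).le)
      tendsto_one_div_add_atTop_nhds_zero_nat
  · intro K hK
    obtain ⟨n, hn⟩ := L.exists_superset_of_isCompact hK
    have h2 : ∀ᶠ ε in 𝓝[>] (0 : ℝ), ∀ k ∈ Finset.range n, ε < e k / 2 :=
      (eventually_all_finset _).2 fun k _ =>
        nhdsWithin_le_nhds (gt_mem_nhds (half_pos (he k).1.1))
    filter_upwards [h2] with ε hε hεS x hx
    obtain ⟨k, hk, -, hk'⟩ := mem_iUnion.1 hεS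
    have hnk : n ≤ k := by
      by_contra! hlt
      exact lt_asymm (hε k (Finset.mem_range.2 hlt)) hk
    exact (hk' x (L.subset hnk (hn hx))).le

/-! ### Points at which finitely many generalized functions take prescribed values. -/

/-- A strictly positive negligible net. -/
def expNet (𝕜 : Type*) [RCLike 𝕜] : scalarModerate 𝕜 :=
  ofRealNet (fun ε => Real.exp (-ε⁻¹))
    (Real.contDiff_exp.comp_contDiffOn (contDiffOn_id.inv fun _ h => h.1.ne').neg)
    fun _ hε => ⟨(Real.exp_pos _).le, Real.exp_le_one_iff.2 (neg_nonpos.2 (inv_pos.2 hε.1).le)⟩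

theorem mkNum_expNet : mkNum (expNet 𝕜) = 0 := by
  rw [mkNum_eq_zero]
  intro m
  refine IsBigO.of_bound m.factorial ?_
  filter_upwards [self_mem_nhdsWithin] with ε (hε : 0 < ε)
  change ‖((Real.exp (-ε⁻¹) : ℝ) : 𝕜)‖ ≤ _
  rw [RCLike.norm_ofReal, abs_of_pos (Real.exp_pos _), Real.norm_of_nonneg (by positivity),
    Real.exp_neg]
  have h := Real.pow_div_factorial_le_exp ε⁻¹ (inv_pos.2 hε).le m
  rw [← inv_inv ((m.factorial : ℝ) * ε ^ m)]
  refine inv_anti₀ (by positivity) (le_of_eq_of_le ?_ h)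
  rw [mul_inv, inv_pow, div_eq_mul_inv, mul_comm]

/-- A fixed smooth function, as a moderate net. -/
def fixedNet (f : Smooth 𝕜 E X) : moderate 𝕜 E X :=
  ⟨fun _ => f, (f.contMDiff.comp contMDiff_snd).contMDiffOn, fun K hK P _ => by
    obtain ⟨C, hC⟩ := hK.exists_bound_of_continuousOn (P f).contMDiff.continuous.continuousOn
    exact ⟨0, uniformBigO_iff.2 ⟨C, Eventually.of_forall fun ε x hx => by simpa using hC x hx⟩⟩⟩

/-- `∑ |u - a u|²`, made strictly positive. -/
def sqDistNet (a : moderate 𝕜 E X → scalarModerate 𝕜) (s : Finset (moderate 𝕜 E X)) :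
    moderate 𝕜 E X :=
  ∑ u ∈ s, (u - constNet 𝕜 E X (a u)) * conjNet (u - constNet 𝕜 E X (a u)) +
    constNet 𝕜 E X (expNet 𝕜)

theorem sqDistNet_apply (a : moderate 𝕜 E X → scalarModerate 𝕜) (s : Finset (moderate 𝕜 E X))
    (ε : ℝ) (x : X) : (sqDistNet a s).1 ε x =
      ((∑ u ∈ s, ‖u.1 ε x - (a u).1 ε‖ ^ 2 + Real.exp (-ε⁻¹) : ℝ) : 𝕜) := by
  have h : ∀ t : Finset (moderate 𝕜 E X),
      (∑ u ∈ t, (u - constNet 𝕜 E X (a u)) * conjNet (u - constNet 𝕜 E X (a u))).1 ε x =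
        ((∑ u ∈ t, ‖u.1 ε x - (a u).1 ε‖ ^ 2 : ℝ) : 𝕜) := by
    classical
    intro t
    induction t using Finset.induction_on with
    | empty => simp
    | insert u t hu ih =>
      rw [Finset.sum_insert hu, Finset.sum_insert hu, RCLike.ofReal_add, ← ih]
      change (u.1 ε x - (a u).1 ε) * starRingEnd 𝕜 (u.1 ε x - (a u).1 ε) + _ = _
      rw [RCLike.mul_conj, RCLike.ofReal_pow]
  rw [RCLike.ofReal_add, ← h]
  rfl

theorem norm_sqDistNet (a : moderate 𝕜 E X → scalarModerate 𝕜) (s : Finset (moderate 𝕜 E X))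
    (ε : ℝ) (x : X) : ‖(sqDistNet a s).1 ε x‖ =
      ∑ u ∈ s, ‖u.1 ε x - (a u).1 ε‖ ^ 2 + Real.exp (-ε⁻¹) := by
  rw [sqDistNet_apply, RCLike.norm_ofReal, abs_of_nonneg (by positivity)]

theorem sq_norm_sub_le {a : moderate 𝕜 E X → scalarModerate 𝕜} {s : Finset (moderate 𝕜 E X)}
    {u : moderate 𝕜 E X} (hu : u ∈ s) (ε : ℝ) (x : X) :
    ‖u.1 ε x - (a u).1 ε‖ ^ 2 ≤ ‖(sqDistNet a s).1 ε x‖ := by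
  rw [norm_sqDistNet]
  have := Finset.single_le_sum (f := fun u : moderate 𝕜 E X => ‖u.1 ε x - (a u).1 ε‖ ^ 2)
    (fun _ _ => by positivity) hu
  linarith [Real.exp_pos (-ε⁻¹)]

theorem sqDistNet_ne_zero (a : moderate 𝕜 E X → scalarModerate 𝕜) (s : Finset (moderate 𝕜 E X))
    (ε : ℝ) (x : X) : (sqDistNet a s).1 ε x ≠ 0 := by
  rw [← norm_pos_iff, norm_sqDistNet]
  positivity

theorem map_sqDistNet (hmul : ∀ u v, ν (u * v) = ν u * ν v) (hne : ν ≠ 0)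
    {a : moderate 𝕜 E X → scalarModerate 𝕜} (ha : ∀ u, ν (mkFun u) = mkNum (a u))
    (s : Finset (moderate 𝕜 E X)) : ν (mkFun (sqDistNet a s)) = 0 := by
  rw [sqDistNet, map_add, map_add, map_constNet hmul hne, mkNum_expNet, add_zero, map_sum, map_sum]
  refine Finset.sum_eq_zero fun u _ => ?_
  rw [map_mul, hmul, map_sub, map_sub, map_constNet hmul hne, ha, sub_self, zero_mul]

-- The index of the first exhausting compact set containing a point is locally bounded by constants;
-- a partition of unity glues these into a smooth function dominating the index.
variable (E X) in
theorem exists_smooth_exhaustion [FiniteDimensional ℝ E] [T2Space X] [SigmaCompactSpace X]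
    [IsManifold 𝓘(ℝ, E) ∞ X] : ∃ f : C^∞⟮𝓘(ℝ, E), X; 𝓘(ℝ, ℝ), ℝ⟯,
      ∀ R : ℝ, ∃ K : Set X, IsCompact K ∧ ∀ x, f x ≤ R → x ∈ K := by
  have : LocallyCompactSpace X := ChartedSpace.locallyCompactSpace E X
  let L := CompactExhaustion.choice X
  obtain ⟨f, hf⟩ := exists_contMDiffMap_forall_mem_convex_of_local_const 𝓘(ℝ, E) (n := ⊤)
    (t := fun x => Ici (L.find x : ℝ)) (fun x => convex_Ici _) fun x => by
      obtain ⟨n, hn⟩ := L.exists_mem_nhds x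
      refine ⟨n, mem_of_superset hn fun y hy => ?_⟩
      exact mem_Ici.2 ((Nat.cast_le (α := ℝ)).2 (L.mem_iff_find_le.1 hy))
  refine ⟨f, fun R => ⟨L ⌈R⌉₊, L.isCompact _, fun x hx => L.mem_iff_find_le.2 ?_⟩⟩
  have h := (hf x).trans (hx.trans (Nat.le_ceil R))
  exact_mod_cast h

/-- Finitely many generalized functions are simultaneously evaluated by `ν` at the points of a
(not necessarily continuous) net in a fixed compact set. -/
theorem exists_compact_points [FiniteDimensional ℝ E] [T2Space X] [SigmaCompactSpace X]
    [IsManifold 𝓘(ℝ, E) ∞ X] (hmul : ∀ u v, ν (u * v) = ν u * ν v) (hne : ν ≠ 0)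
    {a : moderate 𝕜 E X → scalarModerate 𝕜} (ha : ∀ u, ν (mkFun u) = mkNum (a u)) :
    ∃ K : Set X, IsCompact K ∧ ∀ s : Finset (moderate 𝕜 E X), ∃ x : ℝ → X,
      (∀ᶠ ε in 𝓝[>] 0, x ε ∈ K) ∧
      ∀ u ∈ s, Negl (𝓝[>] 0) fun ε => u.1 ε (x ε) - (a u).1 ε := by
  classical
  have : LocallyCompactSpace X := ChartedSpace.locallyCompactSpace E X
  have hsmall : ∀ (s : Finset (moderate 𝕜 E X)) (N : ℕ), ∃ L : Set X, IsCompact L ∧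
      ∀ᶠ ε in 𝓝[>] 0, ∃ x ∈ L, ‖(sqDistNet a s).1 ε x‖ ≤ ε ^ N := fun s =>
    exists_compact_forall_exists_norm_le hmul hne _ (map_sqDistNet hmul hne ha s)
      fun ε _ => sqDistNet_ne_zero a s ε
  obtain ⟨f, hf⟩ := exists_smooth_exhaustion E X
  let F : moderate 𝕜 E X := fixedNet ⟨fun x => (f x : 𝕜),
    (RCLike.ofRealCLM (K := 𝕜)).contDiff.contMDiff.comp f.contMDiff⟩
  have hF : ∀ ε x, F.1 ε x = (f x : 𝕜) := fun _ _ => rfl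
  have hsq : ∀ {s : Finset (moderate 𝕜 E X)} {N : ℕ} {ε : ℝ} {x : X}, F ∈ s →
      ε ∈ Ioo (0 : ℝ) 1 → ‖(sqDistNet a s).1 ε x‖ ≤ ε ^ N →
      ‖(f x : 𝕜) - (a F).1 ε‖ ≤ 1 := by
    intro s N ε x hs hε h
    have h1 := (sq_norm_sub_le hs ε x).trans (h.trans (pow_le_one₀ hε.1.le hε.2.le))
    rw [hF] at h1
    exact (sq_le_one_iff₀ (norm_nonneg _)).1 h1
  -- The case `s = {F}`, `N = 0` already bounds `a F` by `R + 1`. Any point where a sum containing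
  -- the `F` term is at most `1` then satisfies `f x ≤ R + 2`, so `K` depends on neither `s` nor
  -- `N`.
  obtain ⟨L, hL, hL'⟩ := hsmall {F} 0
  obtain ⟨R, hR⟩ := hL.exists_bound_of_continuousOn f.contMDiff.continuous.continuousOn
  obtain ⟨K, hK, hfK⟩ := hf (R + 2)
  have haF : ∀ᶠ ε in 𝓝[>] 0, ‖(a F).1 ε‖ ≤ R + 1 := by
    filter_upwards [hL', Ioo_mem_nhdsGT (zero_lt_one : (0 : ℝ) < 1)] with ε ⟨x, hx, hx'⟩ hε
    have h1 := hsq (Finset.mem_singleton_self F) hε hx'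
    have h2 := hR x hx
    rw [← norm_algebraMap' 𝕜 (f x)] at h2
    change ‖(f x : 𝕜)‖ ≤ R at h2
    have h3 := norm_sub_norm_le ((a F).1 ε) (f x : 𝕜)
    rw [norm_sub_rev] at h3
    linarith
  refine ⟨K, hK, fun s => ?_⟩
  have hmin : ∀ N : ℕ, ∀ᶠ ε in 𝓝[>] 0, ∃ x ∈ K, ‖(sqDistNet a (insert F s)).1 ε x‖ ≤ ε ^ N := by
    intro N
    obtain ⟨L, -, hL⟩ := hsmall (insert F s) N
    filter_upwards [hL, haF, Ioo_mem_nhdsGT (zero_lt_one : (0 : ℝ) < 1)] with ε ⟨x, _, hx'⟩ h1 hε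
    refine ⟨x, hfK x ?_, hx'⟩
    have h2 := hsq (Finset.mem_insert_self F s) hε hx'
    have h3 := norm_sub_norm_le (f x : 𝕜) ((a F).1 ε)
    rw [RCLike.norm_ofReal] at h3
    linarith [le_abs_self (f x)]
  -- A minimizer over `K` meets the bounds for all `N` at once, so one net serves every order.
  have hpt : ∀ ε : ℝ, ∃ x : X, K.Nonempty → x ∈ K ∧ ∀ y ∈ K,
      ‖(sqDistNet a (insert F s)).1 ε x‖ ≤ ‖(sqDistNet a (insert F s)).1 ε y‖ := by
    intro ε
    have hx : K.Nonempty := (hmin 0).exists.elim fun _ ⟨x, hx, _⟩ => ⟨x, hx⟩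
    obtain ⟨x, hx, hx'⟩ := hK.exists_isMinOn hx
      ((sqDistNet a (insert F s)).1 ε).contMDiff.continuous.norm.continuousOn
    exact ⟨x, fun _ => ⟨hx, hx'⟩⟩
  choose x hx using hpt
  refine ⟨x, ?_, fun u hu m => ?_⟩
  · filter_upwards [hmin 0] with ε ⟨y, hy, _⟩ using (hx ε ⟨y, hy⟩).1
  · refine IsBigO.of_bound 1 ?_
    filter_upwards [hmin (m * 2), self_mem_nhdsWithin] with ε ⟨y, hy, hy'⟩ (hε : 0 < ε)
    rw [one_mul, norm_pow, Real.norm_of_nonneg hε.le]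
    have h := (sq_norm_sub_le (a := a) (Finset.mem_insert_of_mem hu) ε (x ε)).trans
      (((hx ε ⟨y, hy⟩).2 y hy).trans hy')
    rw [pow_mul] at h
    exact (sq_le_sq₀ (norm_nonneg _) (by positivity)).1 h

end

/-! ### Smooth nets of points close to a given net -/

section Gluing

theorem Negl.sup {F : Type*} [SeminormedAddCommGroup F] {l l' : Filter ℝ} {r : ℝ → F}
    (h : Negl l r) (h' : Negl l' r) : Negl (l ⊔ l') r := fun m => (h m).sup (h' m)

/-- A smooth function equal to `1` on `(-∞, 1/3]` and to `0` on `[1/2, ∞)`. -/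
def cutoff (σ : ℝ) : ℝ := 1 - Real.smoothTransition (6 * σ - 2)

theorem contDiff_cutoff : ContDiff ℝ ∞ cutoff := by
  unfold cutoff
  fun_prop

theorem cutoff_mem_Icc (σ : ℝ) : cutoff σ ∈ Icc 0 1 :=
  ⟨sub_nonneg.2 (Real.smoothTransition.le_one _),
    sub_le_self _ (Real.smoothTransition.nonneg _)⟩

theorem cutoff_of_le {σ : ℝ} (h : σ ≤ 1 / 3) : cutoff σ = 1 := by
  rw [cutoff, Real.smoothTransition.zero_of_nonpos (by linarith), sub_zero]

theorem cutoff_of_ge {σ : ℝ} (h : 1 / 2 ≤ σ) : cutoff σ = 0 := by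
  rw [cutoff, Real.smoothTransition.one_of_one_le (by linarith), sub_self]

variable {E : Type*} [NormedAddCommGroup E] [NormedSpace ℝ E] [FiniteDimensional ℝ E]
  {X : Type*} [TopologicalSpace X] [T2Space X] [ChartedSpace E X] [IsManifold 𝓘(ℝ, E) ∞ X]

/-- Move `z` towards the point with coordinates `c` in the chart at `q`, to an extent that depends
on `σ`: completely if `σ ≥ 1/2`, and not at all if `σ ≤ 1/3`. -/
def gluePoint {q : X} (χ : SmoothBumpFunction 𝓘(ℝ, E) q) (σ : ℝ) (c : E) (z : X) : X :=
  open Classical in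
  if 1 / 4 < σ then (extChartAt 𝓘(ℝ, E) q).symm (c + cutoff σ • (chartMap χ z - c)) else z

theorem gluePoint_of_ge {q : X} (χ : SmoothBumpFunction 𝓘(ℝ, E) q) {σ : ℝ} (h : 1 / 2 ≤ σ)
    (c : E) (z : X) : gluePoint χ σ c z = (extChartAt 𝓘(ℝ, E) q).symm c := by
  rw [gluePoint, if_pos (by linarith), cutoff_of_ge h, zero_smul, add_zero]

theorem gluePoint_of_gt {q : X} (χ : SmoothBumpFunction 𝓘(ℝ, E) q) {σ : ℝ} (h : 1 / 4 < σ)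
    (c : E) (z : X) : gluePoint χ σ c z =
      (extChartAt 𝓘(ℝ, E) q).symm (c + cutoff σ • (chartMap χ z - c)) := if_pos h

/-- For `σ` between `1/4` and `1/3` the two branches agree inside the patch; this overlap makes the
glued net smooth across the switch at `1/4`. -/
theorem gluePoint_of_le {q : X} (χ : SmoothBumpFunction 𝓘(ℝ, E) q) {σ : ℝ} (h : σ ≤ 1 / 3)
    (c : E) (z : X) (hz : 1 / 4 < σ → z ∈ chartBall χ) : gluePoint χ σ c z = z := by
  by_cases h' : 1 / 4 < σ
  · rw [gluePoint_of_gt χ h', cutoff_of_le h, one_smul, add_sub_cancel, chartMap_eq (hz h'),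
      (extChartAt 𝓘(ℝ, E) q).left_inv (hz h').1]
  · exact if_neg h'

/-- The smooth net `σ` replaces the bump value at `x`, which need not be continuous, as the switch.
Where `σ > 1/4` the chart at `q` contains the points involved, and convex interpolation in
coordinates between `z` and `c` keeps the net close to `x`. -/
theorem exists_glue_step {χ : ∀ p : X, SmoothBumpFunction 𝓘(ℝ, E) p} {t : Finset X} {q : X}
    (hq : q ∈ t) {x z : ℝ → X} {σ : ℝ → ℝ} {c : ℝ → E} (hσ : ContDiffOn ℝ ∞ σ (Ioc 0 1))
    (hc : ContDiffOn ℝ ∞ c (Ioc 0 1))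
    (hσx : Negl (𝓝[>] 0) fun ε => innerBump (χ q) (x ε) - σ ε)
    (hcx : Negl (𝓝[>] 0) fun ε => chartMap (χ q) (x ε) - c ε)
    {A : Set ℝ} (hA : ∀ ε ∈ A, ε ∈ Ioo (0 : ℝ) 1 → A ∈ 𝓝 ε)
    (hz : ∀ᶠ ε in 𝓝[>] 0, ε ∈ A → ContMDiffAt 𝓘(ℝ, ℝ) 𝓘(ℝ, E) ∞ z ε)
    (hxz : TestClose χ t (𝓝[>] 0 ⊓ 𝓟 A) x z) :
    ∃ z' : ℝ → X, (∀ᶠ ε in 𝓝[>] 0, ε ∈ A ∪ {ε | 1 / 2 < σ ε} →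
        ContMDiffAt 𝓘(ℝ, ℝ) 𝓘(ℝ, E) ∞ z' ε) ∧
      TestClose χ t (𝓝[>] 0 ⊓ 𝓟 (A ∪ {ε | 1 / 2 < σ ε})) x z' := by
  have hr := (χ q).rIn_pos
  set B := Metric.ball (extChartAt 𝓘(ℝ, E) q q) (χ q).rIn with hB
  -- With error below `1/8` the bump at `x` is positive, so the coordinates of `x` are within `3/4`
  -- of the inner radius; a further error of `1/8` of that radius keeps `c` inside.
  have hxball : ∀ᶠ ε in 𝓝[>] 0, 1 / 4 < σ ε → x ε ∈ chartBall (χ q) ∧ c ε ∈ B := by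
    filter_upwards [hσx.eventually_lt le_rfl (by norm_num : (0 : ℝ) < 1 / 8),
      hcx.eventually_lt le_rfl (by positivity : 0 < (χ q).rIn / 8)] with ε h1 h2 h3
    rw [Real.norm_eq_abs] at h1
    have h4 : innerBump (χ q) (x ε) ≠ 0 := by
      have := (abs_lt.1 h1).1
      exact (by linarith : 0 < innerBump (χ q) (x ε)).ne'
    have h5 := (mem_ball_of_innerBump_ne_zero h4).2
    have h6 := mem_chartBall_of_innerBump_ne_zero h4
    refine ⟨h6, ?_⟩
    rw [chartMap_eq h6, ← dist_eq_norm] at h2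
    rw [Metric.mem_ball] at h5
    rw [hB, Metric.mem_ball]
    linarith [dist_triangle_left (c ε) (extChartAt 𝓘(ℝ, E) q q) (extChartAt 𝓘(ℝ, E) q (x ε))]
  have hzball : ∀ᶠ ε in 𝓝[>] 0, ε ∈ A → 1 / 4 < σ ε → z ε ∈ chartBall (χ q) := by
    filter_upwards [hσx.eventually_lt le_rfl (by norm_num : (0 : ℝ) < 1 / 8),
      eventually_inf_principal.1 ((hxz q hq).1.eventually_lt inf_le_left
        (by norm_num : (0 : ℝ) < 1 / 16))] with ε h1 h2 h3 h4
    have h5 := h2 h3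
    rw [Real.norm_eq_abs] at h1 h5
    refine mem_chartBall_of_innerBump_ne_zero (ne_of_gt ?_)
    linarith [(abs_lt.1 h1).1, (abs_lt.1 h5).2]
  have harg : ∀ᶠ ε in 𝓝[>] 0, ε ∈ A → 1 / 4 < σ ε →
      c ε + cutoff (σ ε) • (chartMap (χ q) (z ε) - c ε) ∈ B := by
    filter_upwards [hxball, hzball] with ε h1 h2 h3 h4
    refine (convex_ball _ _).add_smul_sub_mem (h1 h4).2 ?_ (cutoff_mem_Icc _)
    rw [chartMap_eq (h2 h3 h4)]
    exact (h2 h3 h4).2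
  refine ⟨fun ε => gluePoint (χ q) (σ ε) (c ε) (z ε), ?_, ?_⟩
  · obtain ⟨δ, hδ, hδ'⟩ := mem_nhdsGT_iff_exists_Ioo_subset.1
      (inter_mem (inter_mem (inter_mem hz hxball) (inter_mem hzball harg))
        (Ioo_mem_nhdsGT (zero_lt_one : (0 : ℝ) < 1)))
    filter_upwards [Ioo_mem_nhdsGT (show (0 : ℝ) < δ from hδ)] with ε hε hεA
    obtain ⟨⟨⟨h1, h2⟩, h3, h4⟩, h01⟩ := hδ' hε
    have hσε : ContDiffAt ℝ ∞ σ ε := hσ.contDiffAt (Ioc_mem_nhds h01.1 h01.2)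
    have hcε : ContMDiffAt 𝓘(ℝ, ℝ) 𝓘(ℝ, E) ∞ c ε :=
      (hc.contDiffAt (Ioc_mem_nhds h01.1 h01.2)).contMDiffAt
    have hsymm : ∀ y ∈ B, ContMDiffAt 𝓘(ℝ, E) 𝓘(ℝ, E) ∞ (extChartAt 𝓘(ℝ, E) q).symm y :=
      fun y hy => (contMDiffOn_extChartAt_symm q).contMDiffAt ((isOpen_target q).mem_nhds
        (closedBall_rIn_subset_target (χ q) (Metric.ball_subset_closedBall hy)))
    by_cases hlarge : 1 / 2 < σ ε
    · refine (ContMDiffAt.comp ε (hsymm _ (h2 (by linarith)).2) hcε).congr_of_eventuallyEq ?_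
      filter_upwards [hσε.continuousAt.eventually (lt_mem_nhds hlarge)] with ε' hε'
      exact gluePoint_of_ge _ hε'.le _ _
    · have hεA' : ε ∈ A := hεA.resolve_right hlarge
      by_cases hmid : 1 / 4 < σ ε
      · have hzε : ContMDiffAt 𝓘(ℝ, ℝ) 𝓘(ℝ, E) ∞ (fun ε => chartMap (χ q) (z ε)) ε :=
          (contMDiff_chartMap (χ q)).contMDiffAt.comp ε (h1 hεA')
        have hl : ContMDiffAt 𝓘(ℝ, ℝ) 𝓘(ℝ, E) ∞
            (fun ε => c ε + cutoff (σ ε) • (chartMap (χ q) (z ε) - c ε)) ε := by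
          rw [contMDiffAt_iff_contDiffAt] at hcε hzε ⊢
          exact hcε.add ((contDiff_cutoff.contDiffAt.comp ε hσε).smul (hzε.sub hcε))
        refine (ContMDiffAt.comp ε (hsymm _ (h4 hεA' hmid)) hl).congr_of_eventuallyEq ?_
        filter_upwards [hσε.continuousAt.eventually (lt_mem_nhds hmid)] with ε' hε'
        exact gluePoint_of_gt _ hε' _ _
      · refine (h1 hεA').congr_of_eventuallyEq ?_
        filter_upwards [hσε.continuousAt.eventually
          (gt_mem_nhds (by linarith : σ ε < 1 / 3)), hA ε hεA' h01, isOpen_Ioo.mem_nhds hε]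
          with ε' h5 h6 h7
        exact gluePoint_of_le _ h5.le _ _ ((hδ' h7).1.2.1 h6)
  · have hlA : 𝓝[>] (0 : ℝ) ⊓ 𝓟 (A ∩ {ε | 1 / 4 < σ ε}) ≤ 𝓝[>] 0 ⊓ 𝓟 A :=
      inf_le_inf_left _ (principal_mono.2 inter_subset_left)
    have hA' : ∀ᶠ ε in 𝓝[>] (0 : ℝ) ⊓ 𝓟 (A ∩ {ε | 1 / 4 < σ ε}),
        ε ∈ A ∧ 1 / 4 < σ ε := mem_inf_of_right (mem_principal_self _)
    have hJ : ∀ᶠ ε in 𝓝[>] (0 : ℝ) ⊓ 𝓟 {ε | 1 / 2 < σ ε}, 1 / 2 < σ ε :=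
      mem_inf_of_right (mem_principal_self _)
    have hxA : ∀ᶠ ε in 𝓝[>] (0 : ℝ) ⊓ 𝓟 (A ∩ {ε | 1 / 4 < σ ε}), x ε ∈ chartBall (χ q) := by
      filter_upwards [hA', mem_inf_of_left hxball] with ε h1 h2 using (h2 h1.2).1
    have hxJ : ∀ᶠ ε in 𝓝[>] (0 : ℝ) ⊓ 𝓟 {ε | 1 / 2 < σ ε}, x ε ∈ chartBall (χ q) := by
      filter_upwards [hJ, mem_inf_of_left hxball] with ε h1 h2 using (h2 (by linarith)).1
    have hzA : ∀ᶠ ε in 𝓝[>] (0 : ℝ) ⊓ 𝓟 (A ∩ {ε | 1 / 4 < σ ε}),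
        gluePoint (χ q) (σ ε) (c ε) (z ε) ∈ chartBall (χ q) := by
      filter_upwards [hA', mem_inf_of_left harg] with ε h1 h2
      rw [gluePoint_of_gt _ h1.2]
      exact (symm_mem_chartBall (h2 h1.1 h1.2)).1
    have hzJ : ∀ᶠ ε in 𝓝[>] (0 : ℝ) ⊓ 𝓟 {ε | 1 / 2 < σ ε},
        gluePoint (χ q) (σ ε) (c ε) (z ε) ∈ chartBall (χ q) := by
      filter_upwards [hJ, mem_inf_of_left hxball] with ε h1 h2
      rw [gluePoint_of_ge _ (le_of_lt h1)]
      exact (symm_mem_chartBall (h2 (by linarith)).2).1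
    have hnA : Negl (𝓝[>] (0 : ℝ) ⊓ 𝓟 (A ∩ {ε | 1 / 4 < σ ε})) fun ε =>
        extChartAt 𝓘(ℝ, E) q (x ε) -
          extChartAt 𝓘(ℝ, E) q (gluePoint (χ q) (σ ε) (c ε) (z ε)) := by
      have h1 := hcx.mono (inf_le_left : 𝓝[>] (0 : ℝ) ⊓ 𝓟 (A ∩ {ε | 1 / 4 < σ ε}) ≤ _)
      have h2 := (hxz q hq).2.mono hlA
      intro m
      refine (IsBigO.of_bound 1 ?_).trans ((h1 m).norm_left.add (h2 m).norm_left)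
      filter_upwards [hA', hxA, mem_inf_of_left harg] with ε h3 h4 h5
      rw [gluePoint_of_gt _ h3.2, (symm_mem_chartBall (h5 h3.1 h3.2)).2, ← chartMap_eq h4]
      obtain ⟨h6, h7⟩ := cutoff_mem_Icc (σ ε)
      -- The interpolation error is the same convex combination of two negligible differences.
      have : chartMap (χ q) (x ε) - (c ε + cutoff (σ ε) • (chartMap (χ q) (z ε) - c ε)) =
          (1 - cutoff (σ ε)) • (chartMap (χ q) (x ε) - c ε) +
            cutoff (σ ε) • (chartMap (χ q) (x ε) - chartMap (χ q) (z ε)) := by module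
      rw [this, one_mul, Real.norm_of_nonneg (by positivity)]
      refine (norm_add_le _ _).trans (add_le_add ?_ ?_)
      · rw [norm_smul, Real.norm_of_nonneg (by linarith)]
        exact mul_le_of_le_one_left (norm_nonneg _) (by linarith)
      · rw [norm_smul, Real.norm_of_nonneg h6]
        exact mul_le_of_le_one_left (norm_nonneg _) h7
    have hnJ : Negl (𝓝[>] (0 : ℝ) ⊓ 𝓟 {ε | 1 / 2 < σ ε}) fun ε =>
        extChartAt 𝓘(ℝ, E) q (x ε) -
          extChartAt 𝓘(ℝ, E) q (gluePoint (χ q) (σ ε) (c ε) (z ε)) := by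
      refine (hcx.mono (inf_le_left : 𝓝[>] (0 : ℝ) ⊓ 𝓟 {ε | 1 / 2 < σ ε} ≤ _)).congr ?_
      filter_upwards [hJ, hxJ, mem_inf_of_left hxball] with ε h1 h2 h3
      rw [gluePoint_of_ge _ (le_of_lt h1), (symm_mem_chartBall (h3 (by linarith)).2).2,
        chartMap_eq h2]
    have hsmall : ∀ᶠ ε in 𝓝[>] (0 : ℝ) ⊓ 𝓟 (A ∩ {ε | σ ε ≤ 1 / 4}),
        z ε = gluePoint (χ q) (σ ε) (c ε) (z ε) := by
      have : ∀ᶠ ε in 𝓝[>] (0 : ℝ) ⊓ 𝓟 (A ∩ {ε | σ ε ≤ 1 / 4}), ε ∈ A ∧ σ ε ≤ 1 / 4 :=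
        mem_inf_of_right (mem_principal_self _)
      filter_upwards [this] with ε hε
      exact (if_neg hε.2.not_gt).symm
    -- Three regimes: the net is unchanged, interpolated in the chart, or (for `σ > 1/2`, where `z`
    -- may be uncontrolled) given by `c` alone.
    have hcover : 𝓝[>] (0 : ℝ) ⊓ 𝓟 (A ∪ {ε | 1 / 2 < σ ε}) ≤
        (𝓝[>] 0 ⊓ 𝓟 (A ∩ {ε | σ ε ≤ 1 / 4})) ⊔ ((𝓝[>] 0 ⊓ 𝓟 (A ∩ {ε | 1 / 4 < σ ε})) ⊔
          (𝓝[>] 0 ⊓ 𝓟 {ε | 1 / 2 < σ ε})) := by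
      rw [← inf_sup_left, ← inf_sup_left, sup_principal, sup_principal]
      refine inf_le_inf_left _ (principal_mono.2 ?_)
      rintro ε (hε | hε)
      · rcases le_or_gt (σ ε) (1 / 4) with h | h
        · exact Or.inl ⟨hε, h⟩
        · exact Or.inr (Or.inl ⟨hε, h⟩)
      · exact Or.inr (Or.inr hε)
    have hlA' : 𝓝[>] (0 : ℝ) ⊓ 𝓟 (A ∩ {ε | σ ε ≤ 1 / 4}) ≤ 𝓝[>] 0 ⊓ 𝓟 A :=
      inf_le_inf_left _ (principal_mono.2 inter_subset_left)
    refine fun p hp => ⟨Negl.mono (Negl.sup ?_ (Negl.sup ?_ ?_)) hcover,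
      Negl.mono (Negl.sup ?_ (Negl.sup ?_ ?_)) hcover⟩
    · exact ((hxz p hp).1.mono hlA').congr (hsmall.mono fun ε h =>
        congrArg (fun y => innerBump (χ p) (x ε) - innerBump (χ p) y) h)
    · exact negl_sub_of_contMDiff (innerBump (χ p)).contMDiff (χ q) hxA hzA hnA
    · exact negl_sub_of_contMDiff (innerBump (χ p)).contMDiff (χ q) hxJ hzJ hnJ
    · exact ((hxz p hp).2.mono hlA').congr (hsmall.mono fun ε h =>
        congrArg (fun y => chartMap (χ p) (x ε) - chartMap (χ p) y) h)
    · exact negl_sub_of_contMDiff (contMDiff_chartMap (χ p)) (χ q) hxA hzA hnA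
    · exact negl_sub_of_contMDiff (contMDiff_chartMap (χ p)) (χ q) hxJ hzJ hnJ

/-- Charts are added one at a time, each enlarging the parameter set on which a smooth close net is
available; for no chart this set is empty. -/
theorem exists_glue {χ : ∀ p : X, SmoothBumpFunction 𝓘(ℝ, E) p} {t : Finset X}
    {x : ℝ → X} {s : X → ℝ → ℝ} {c : X → ℝ → E} (hs : ∀ p ∈ t, ContDiffOn ℝ ∞ (s p) (Ioc 0 1))
    (hc : ∀ p ∈ t, ContDiffOn ℝ ∞ (c p) (Ioc 0 1))
    (hsx : ∀ p ∈ t, Negl (𝓝[>] 0) fun ε => innerBump (χ p) (x ε) - s p ε)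
    (hcx : ∀ p ∈ t, Negl (𝓝[>] 0) fun ε => chartMap (χ p) (x ε) - c p ε)
    {t' : Finset X} (ht' : t' ⊆ t) :
    ∃ z : ℝ → X, (∀ᶠ ε in 𝓝[>] 0, ε ∈ {ε | ∃ p ∈ t', 1 / 2 < s p ε} →
        ContMDiffAt 𝓘(ℝ, ℝ) 𝓘(ℝ, E) ∞ z ε) ∧
      TestClose χ t (𝓝[>] 0 ⊓ 𝓟 {ε | ∃ p ∈ t', 1 / 2 < s p ε}) x z := by
  classical
  induction t' using Finset.induction_on with
  | empty =>
    refine ⟨x, Eventually.of_forall fun ε h => by simp at h, fun p _ => ?_⟩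
    simp only [Finset.notMem_empty, false_and, exists_false, ofPred_false, principal_empty,
      inf_bot_eq]
    exact ⟨fun _ => isBigO_bot _ _, fun _ => isBigO_bot _ _⟩
  | insert q t' _ ih =>
    have ht := fun p hp => ht' (Finset.mem_insert_of_mem (b := q) (a := p) hp)
    have hq := ht' (Finset.mem_insert_self q t')
    obtain ⟨z, hz, hxz⟩ := ih ht
    have hU : {ε | ∃ p ∈ insert q t', 1 / 2 < s p ε} =
        {ε | ∃ p ∈ t', 1 / 2 < s p ε} ∪ {ε | 1 / 2 < s q ε} := by
      ext ε
      simp [or_comm]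
    rw [hU]
    refine exists_glue_step hq (hs q hq) (hc q hq) (hsx q hq) (hcx q hq) ?_ hz hxz
    rintro ε ⟨p, hp, h⟩ hε
    filter_upwards [((hs p (ht p hp)).continuousOn.continuousAt
      (Ioc_mem_nhds hε.1 hε.2)).eventually (lt_mem_nhds h)] with ε' h'
    exact ⟨p, hp, h'⟩

/-- A map that is smooth on a small interval `(0, δ)` can be modified away from `0` so that it
becomes smooth on `(0, 1]`. -/
theorem exists_contMDiffOn_eventuallyEq {z : ℝ → X}
    (hz : ∀ᶠ ε in 𝓝[>] 0, ContMDiffAt 𝓘(ℝ, ℝ) 𝓘(ℝ, E) ∞ z ε) :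
    ∃ z' : ℝ → X, ContMDiffOn 𝓘(ℝ, ℝ) 𝓘(ℝ, E) ∞ z' (Ioc 0 1) ∧ z =ᶠ[𝓝[>] 0] z' := by
  obtain ⟨δ, hδ : 0 < δ, hδ'⟩ := mem_nhdsGT_iff_exists_Ioo_subset.1 hz
  -- A smooth reparametrization with values in `(0, δ)` on `(0, 1]`: the identity up to `δ/4` and
  -- the constant `δ/2` from `δ/2` on.
  let θ : ℝ → ℝ := fun ε => ε + Real.smoothTransition (4 / δ * ε - 1) * (δ / 2 - ε)
  have hθ : ContDiff ℝ ∞ θ := by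
    change ContDiff ℝ ∞ fun ε => ε + Real.smoothTransition (4 / δ * ε - 1) * (δ / 2 - ε)
    fun_prop
  refine ⟨fun ε => z (θ ε), fun ε hε => ?_, ?_⟩
  · refine ((hδ' ?_ : ContMDiffAt 𝓘(ℝ, ℝ) 𝓘(ℝ, E) ∞ z (θ ε)).comp ε
      hθ.contMDiff.contMDiffAt).contMDiffWithinAt
    have h0 := Real.smoothTransition.nonneg (4 / δ * ε - 1)
    have h1 := Real.smoothTransition.le_one (4 / δ * ε - 1)
    rcases lt_or_ge ε δ with h | h
    · have : θ ε = (1 - Real.smoothTransition (4 / δ * ε - 1)) • ε +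
          Real.smoothTransition (4 / δ * ε - 1) • (δ / 2) := by
        simp only [θ, smul_eq_mul]
        ring
      rw [this]
      exact convex_Ioo 0 δ ⟨hε.1, h⟩ ⟨half_pos hδ, half_lt_self hδ⟩ (sub_nonneg.2 h1) h0
        (by ring)
    · have h2 : 1 ≤ 4 / δ * ε - 1 := by
        have : 4 / δ * δ ≤ 4 / δ * ε := by gcongr
        rw [div_mul_cancel₀ _ hδ.ne'] at this
        linarith
      have : θ ε = δ / 2 := by
        simp only [θ]
        rw [Real.smoothTransition.one_of_one_le h2]
        ring
      rw [this]
      exact ⟨half_pos hδ, half_lt_self hδ⟩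
  · filter_upwards [Ioo_mem_nhdsGT (show (0 : ℝ) < δ / 4 by positivity)] with ε hε
    have h2 : 4 / δ * ε - 1 ≤ 0 := by
      have : 4 / δ * ε ≤ 4 / δ * (δ / 4) := by
        gcongr
        exact hε.2.le
      rw [div_mul_div_cancel₀ hδ.ne'] at this
      linarith
    have : θ ε = ε := by
      simp only [θ]
      rw [Real.smoothTransition.zero_of_nonpos h2]
      ring
    rw [this]

/-- A net of points whose test functions are smooth up to negligible nets is close to a smooth
net. -/
theorem exists_smooth_testClose {χ : ∀ p : X, SmoothBumpFunction 𝓘(ℝ, E) p} {t : Finset X}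
    {x : ℝ → X} {s : X → ℝ → ℝ} {c : X → ℝ → E} (hs : ∀ p ∈ t, ContDiffOn ℝ ∞ (s p) (Ioc 0 1))
    (hc : ∀ p ∈ t, ContDiffOn ℝ ∞ (c p) (Ioc 0 1))
    (hsx : ∀ p ∈ t, Negl (𝓝[>] 0) fun ε => innerBump (χ p) (x ε) - s p ε)
    (hcx : ∀ p ∈ t, Negl (𝓝[>] 0) fun ε => chartMap (χ p) (x ε) - c p ε)
    (hx : ∀ᶠ ε in 𝓝[>] 0, ∃ p ∈ t, innerBump (χ p) (x ε) = 1) :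
    ∃ z : ℝ → X, ContMDiffOn 𝓘(ℝ, ℝ) 𝓘(ℝ, E) ∞ z (Ioc 0 1) ∧ TestClose χ t (𝓝[>] 0) x z := by
  obtain ⟨z, hz, hxz⟩ := exists_glue hs hc hsx hcx (Finset.Subset.refl t)
  -- Some bump equals `1` at `x`, and its smooth substitute differs by less than `1/2`; hence the
  -- glued region contains all small `ε`.
  have hA : {ε | ∃ p ∈ t, 1 / 2 < s p ε} ∈ 𝓝[>] (0 : ℝ) := by
    filter_upwards [hx, (eventually_all_finset t).2 fun p hp =>
      (hsx p hp).eventually_lt le_rfl one_half_pos] with ε ⟨p, hp, h1⟩ h2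
    refine ⟨p, hp, ?_⟩
    have := h2 p hp
    rw [h1, Real.norm_eq_abs] at this
    linarith [(abs_lt.1 this).2]
  rw [inf_eq_left.2 (le_principal_iff.2 hA)] at hxz
  obtain ⟨z', hz', h⟩ := exists_contMDiffOn_eventuallyEq
    ((hz.and hA).mono fun ε h => h.1 h.2)
  exact ⟨z', hz', fun p hp => ⟨(hxz p hp).1.congr (h.mono fun ε h =>
    congrArg (fun y => innerBump (χ p) (x ε) - innerBump (χ p) y) h),
    (hxz p hp).2.congr (h.mono fun ε h =>
    congrArg (fun y => chartMap (χ p) (x ε) - chartMap (χ p) y) h)⟩⟩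

end Gluing

/-! ### Test functions -/

section Tests

variable {𝕜 : Type*} [RCLike 𝕜]

theorem Negl.sum_smul {F ι : Type*} [NormedAddCommGroup F] [NormedSpace ℝ F] (t : Finset ι)
    {l : Filter ℝ} {r : ι → ℝ → ℝ} (h : ∀ i ∈ t, Negl l (r i)) (v : ι → F) :
    Negl l fun ε => ∑ i ∈ t, r i ε • v i := fun m =>
  IsBigO.fun_sum fun i hi => (((h i hi).of_le ‖v i‖ (Eventually.of_forall fun ε => by
    rw [norm_smul, mul_comm]) : Negl l fun ε => r i ε • v i)) m

theorem Negl.re_sub {l : Filter ℝ} {r : ℝ → ℝ} {α : ℝ → 𝕜}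
    (h : Negl l fun ε => (r ε : 𝕜) - α ε) : Negl l fun ε => r ε - RCLike.re (α ε) :=
  h.of_le 1 <| Eventually.of_forall fun ε => by
    have := RCLike.abs_re_le_norm ((r ε : 𝕜) - α ε)
    rwa [map_sub, RCLike.ofReal_re, ← Real.norm_eq_abs, ← one_mul ‖(r ε : 𝕜) - α ε‖] at this

variable {E : Type*} [NormedAddCommGroup E] [NormedSpace ℝ E] [FiniteDimensional ℝ E]
  {X : Type*} [TopologicalSpace X] [T2Space X] [ChartedSpace E X] [IsManifold 𝓘(ℝ, E) ∞ X]

variable (𝕜) in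
/-- A smooth real function, as a `𝕜`-valued one. -/
def ofRealSmooth {f : X → ℝ} (hf : ContMDiff 𝓘(ℝ, E) 𝓘(ℝ, ℝ) ∞ f) : Smooth 𝕜 E X :=
  ⟨fun x => (f x : 𝕜), (RCLike.ofRealCLM (K := 𝕜)).contDiff.contMDiff.comp hf⟩

variable (𝕜) in
/-- The inner bump function of a patch, as a net of functions. -/
def bumpTest {p : X} (χ : SmoothBumpFunction 𝓘(ℝ, E) p) : moderate 𝕜 E X :=
  fixedNet (ofRealSmooth 𝕜 (innerBump χ).contMDiff)

variable (𝕜) in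
/-- A coordinate of a patch, as a net of functions. -/
def coordTest {p : X} (χ : SmoothBumpFunction 𝓘(ℝ, E) p) (k : Fin (Module.finrank ℝ E)) :
    moderate 𝕜 E X :=
  fixedNet (ofRealSmooth 𝕜 ((LinearMap.toContinuousLinearMap
    ((Module.finBasis ℝ E).coord k)).contDiff.contMDiff.comp (contMDiff_chartMap χ)))

variable (𝕜) in
open Classical in
/-- The test functions of finitely many patches. -/
def tests (χ : ∀ p : X, SmoothBumpFunction 𝓘(ℝ, E) p) (t : Finset X) :
    Finset (moderate 𝕜 E X) :=
  t.image (fun p => bumpTest 𝕜 (χ p)) ∪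
    (t ×ˢ Finset.univ).image fun q => coordTest 𝕜 (χ q.1) q.2

/-- The tests are real-valued, so real parts of `α` suffice, and a basis reassembles the
coordinates. Below, `α` is either the net representing `ν` or the values at a second net of points.
-/
theorem negl_of_tests {χ : ∀ p : X, SmoothBumpFunction 𝓘(ℝ, E) p} {t : Finset X} {x : ℝ → X}
    {l : Filter ℝ} {α : moderate 𝕜 E X → ℝ → 𝕜}
    (h : ∀ u ∈ tests 𝕜 χ t, Negl l fun ε => u.1 ε (x ε) - α u ε) {p : X} (hp : p ∈ t) :
    (Negl l fun ε => innerBump (χ p) (x ε) - RCLike.re (α (bumpTest 𝕜 (χ p)) ε)) ∧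
    Negl l fun ε => chartMap (χ p) (x ε) -
      ∑ k, RCLike.re (α (coordTest 𝕜 (χ p) k) ε) • Module.finBasis ℝ E k := by
  classical
  refine ⟨Negl.re_sub (h (bumpTest 𝕜 (χ p))
    (Finset.mem_union_left _ (Finset.mem_image_of_mem _ hp))), ?_⟩
  have hk : ∀ k ∈ Finset.univ, Negl l fun ε => (Module.finBasis ℝ E).coord k
      (chartMap (χ p) (x ε)) - RCLike.re (α (coordTest 𝕜 (χ p) k) ε) := fun k _ =>
    Negl.re_sub (h (coordTest 𝕜 (χ p) k) (Finset.mem_union_right _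
      (Finset.mem_image.2 ⟨(p, k), by simp [hp], rfl⟩)))
  refine (Negl.sum_smul Finset.univ hk (Module.finBasis ℝ E)).congr
    (Eventually.of_forall fun ε => ?_)
  simp only [sub_smul, Finset.sum_sub_distrib, Module.Basis.coord_apply, Module.Basis.sum_repr]

variable (𝕜) in
theorem testClose_of_tests {χ : ∀ p : X, SmoothBumpFunction 𝓘(ℝ, E) p} {t : Finset X}
    {x y : ℝ → X} {l : Filter ℝ}
    (h : ∀ u ∈ tests 𝕜 χ t, Negl l fun ε => u.1 ε (x ε) - u.1 ε (y ε)) :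
    TestClose χ t l x y := by
  intro p hp
  obtain ⟨h1, h2⟩ := negl_of_tests h hp
  refine ⟨h1.congr (Eventually.of_forall fun ε => ?_),
    h2.congr (Eventually.of_forall fun ε => ?_)⟩
  · exact congrArg (innerBump (χ p) (x ε) - ·) (RCLike.ofReal_re _)
  · refine congrArg (chartMap (χ p) (x ε) - ·) (Eq.trans ?_
      ((Module.finBasis ℝ E).sum_repr (chartMap (χ p) (y ε))))
    exact Finset.sum_congr rfl fun k _ => congrArg (· • Module.finBasis ℝ E k)
      (RCLike.ofReal_re _)

end Tests

/-! ### Characters are evaluations -/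

section Characters

variable {𝕜 : Type*} [RCLike 𝕜]
  {E : Type*} [NormedAddCommGroup E] [NormedSpace ℝ E] [FiniteDimensional ℝ E]
  {X : Type*} [TopologicalSpace X] [T2Space X] [ChartedSpace E X] [IsManifold 𝓘(ℝ, E) ∞ X]

theorem TestClose.exists_compact {χ : ∀ p : X, SmoothBumpFunction 𝓘(ℝ, E) p} {t : Finset X}
    {x z : ℝ → X} (h : TestClose χ t (𝓝[>] 0) x z)
    (hx : ∀ᶠ ε in 𝓝[>] 0, ∃ p ∈ t, innerBump (χ p) (x ε) = 1) :
    ∃ K : Set X, IsCompact K ∧ ∀ᶠ ε in 𝓝[>] 0, z ε ∈ K := by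
  refine ⟨⋃ p ∈ t, tsupport (innerBump (χ p)),
    t.isCompact_biUnion fun p _ => (innerBump (χ p)).hasCompactSupport, ?_⟩
  filter_upwards [hx, (eventually_all_finset t).2 fun p hp =>
    (h p hp).1.eventually_lt le_rfl one_pos] with ε ⟨p, hp, h1⟩ h2
  refine mem_biUnion hp (subset_tsupport _ fun h0 => ?_)
  have := h2 p hp
  rw [h1, h0, sub_zero, norm_one] at this
  exact lt_irrefl _ this

/-- Every multiplicative functional is the evaluation at a compactly supported net. -/
theorem exists_eq_evalNet [SigmaCompactSpace X]
    {ν : GenFun 𝕜 E X →ₗ[GenNumber 𝕜] GenNumber 𝕜}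
    (hmul : ∀ u v, ν (u * v) = ν u * ν v) (hne : ν ≠ 0) :
    ∃ z : CompactNet E X, ∀ u, ν u = evalNet 𝕜 z u := by
  classical
  choose a ha using fun u : moderate 𝕜 E X => mkNum_surjective (ν (mkFun u))
  obtain ⟨K, hK, hpts⟩ := exists_compact_points hmul hne fun u => (ha u).symm
  let χ : ∀ p : X, SmoothBumpFunction 𝓘(ℝ, E) p := fun p => Classical.choice inferInstance
  obtain ⟨t, ht⟩ := exists_finset_innerBump_eq_one χ hK
  obtain ⟨x, hxK, hx⟩ := hpts (tests 𝕜 χ t)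
  have hcov := hxK.mono fun ε h => ht _ h
  have hre : ∀ u, ContDiffOn ℝ ∞ (fun ε => RCLike.re ((a u).1 ε)) (Ioc 0 1) := fun u =>
    (RCLike.reCLM (K := 𝕜)).contDiff.comp_contDiffOn (a u).2.1
  obtain ⟨z, hz, hxz⟩ := exists_smooth_testClose (fun p _ => hre (bumpTest 𝕜 (χ p)))
    (fun p _ => ContDiffOn.sum fun k _ =>
      (hre (coordTest 𝕜 (χ p) k)).smul contDiffOn_const)
    (fun p hp => (negl_of_tests hx hp).1) (fun p hp => (negl_of_tests hx hp).2) hcov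
  refine ⟨⟨z, hz, hxz.exists_compact hcov⟩, fun u => ?_⟩
  obtain ⟨u, rfl⟩ := mkFun_surjective u
  rw [← ha u, eq_comm, evalNet_mkFun_eq]
  -- The net `x` knows nothing of `u`. The net `x'` also represents `ν u`, and it is linked to `z`
  -- through the values of `ν` on the common tests.
  obtain ⟨x', hxK', hx'⟩ := hpts (insert u (tests 𝕜 χ t))
  have hxx' : TestClose χ t (𝓝[>] 0) x' x := testClose_of_tests 𝕜 fun v hv =>
    (hx' v (Finset.mem_insert_of_mem hv)).trans (hx v hv).symm
  have hxz' : TestClose χ t (𝓝[>] 0) x' z := fun p hp =>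
    ⟨(hxx' p hp).1.trans (hxz p hp).1, (hxx' p hp).2.trans (hxz p hp).2⟩
  exact (hxz'.negl_sub (hxK'.mono fun ε h => ht _ h) u).symm.trans
    (hx' u (Finset.mem_insert_self u _))

/-- Two compactly supported nets are equivalent if and only if all generalized functions take the
same values at them. -/
theorem equiv_iff_evalNet_eq [SecondCountableTopology X] (y z : CompactNet E X) :
    y ≈ z ↔ ∀ u, evalNet 𝕜 y u = evalNet 𝕜 z u := by
  obtain ⟨K, hK, hyK⟩ := y.compact
  constructor
  · intro h u
    obtain ⟨u, rfl⟩ := mkFun_surjective u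
    rw [evalNet_mkFun_eq_evalNet]
    -- One metric is enough in this direction; its existence keeps the equivalence relation from
    -- being vacuous.
    obtain ⟨g⟩ := nonempty_rMetric E X
    let χ : ∀ p : X, SmoothBumpFunction 𝓘(ℝ, E) p := fun p => Classical.choice inferInstance
    obtain ⟨t, ht⟩ := exists_finset_innerBump_eq_one χ hK
    exact (TestClose.of_dist g χ t (h g)).negl_sub (hyK.mono fun ε h => ht _ h) u
  · intro h g m
    -- The patches are adapted to `g`, so that coordinate distance dominates its distance on each of
    -- them.
    choose C χ hC using g.exists_dist_le
    obtain ⟨t, ht⟩ := exists_finset_innerBump_eq_one χ hK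
    have : TestClose χ t (𝓝[>] 0) y.toFun z.toFun := testClose_of_tests 𝕜 fun u _ =>
      (evalNet_mkFun_eq_evalNet y z u).1 (h (mkFun u))
    exact this.dist_le hC (hyK.mono fun ε h => ht _ h) m

end Characters

end Colombeau

end

/-- In the conclusion, a net `x` represents the generalized point `p` if and only if `ν` is the
evaluation at `x`; so the value `u(p)` does not depend on the representative of `p`, it equals
`ν u` for all `u`, and no other generalized point has this property. -/
theorem mainTheorem3 {𝕜 : Type*} [RCLike 𝕜]
    {E : Type*} [NormedAddCommGroup E] [NormedSpace ℝ E] [FiniteDimensional ℝ E]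
    {X : Type*} [TopologicalSpace X] [T2Space X] [SecondCountableTopology X]
    [ChartedSpace E X] [IsManifold 𝓘(ℝ, E) ∞ X]
    (ν : Colombeau.GenFun 𝕜 E X →ₗ[Colombeau.GenNumber 𝕜] Colombeau.GenNumber 𝕜)
    (hmul : ∀ u v, ν (u * v) = ν u * ν v) (hne : ν ≠ 0) :
    ∃! p : Colombeau.GenPoint E X, ∀ x : Colombeau.CompactNet E X,
      (Quotient.mk _ x = p ↔ ∀ u, ν u = Colombeau.evalNet 𝕜 x u) := by
  have : LocallyCompactSpace X := ChartedSpace.locallyCompactSpace E X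
  obtain ⟨z, hz⟩ := Colombeau.exists_eq_evalNet hmul hne
  refine ⟨Quotient.mk _ z, fun x => ?_, fun p hp => ((hp z).2 hz).symm⟩
  rw [Quotient.eq]
  refine (Colombeau.equiv_iff_evalNet_eq (𝕜 := 𝕜) x z).trans (forall_congr' fun u => ?_)
  rw [hz u, eq_comm]
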